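/- **Setting.** Fix real numbers $\tfrac12<s\le t<1$, $0<d\le 1$ and $M>0$. For $a\ge 1$, $\theta\in[0,2\pi)$ put $A_a=\begin{pmatrix}a^t&0\\0&a^s\end{pmatrix}$, $R_\theta=\begin{pmatrix}\cos\theta&-\sin\theta\\ \sin\theta&\cos\theta\end{pmatrix}$, $e_\theta=(\cos\theta,\sin\theta)^{\mathrm T}$. Fix a mother wave packet $w$: a Schwartz function on $\mathbb R^2$ whose Fourier transform $\widehat w(\xi)=\int w(x)e^{-2\pi i x\cdot\xi}\,dx$ is real, non-negative and radial, has support equal to the closed ball of radius $d$ about $0$, and satisfies, for some $0<c_1<c_2<\infty$, $$c_1\le\int_0^{2\pi}\!\int_1^\infty a^{-(t+s)}\left|\widehat w\left(A_a^{-1}R_\theta^{-1}(\xi-a e_\theta)\right)\right|^2 a\,da\,d\theta\le c_2\qquad(|\xi|\ge1).$$ Let $w_{a\theta b}(x)=a^{\frac{t+s}2}e^{2\pi i a(x-b)\cdot e_\theta}\,w(A_aR_\theta^{-1}(x-b))$. For $f$ on $\mathbb R^2$ let $$W_f(a,\theta,b)=\int_{\mathbb R^2}\overline{w_{a\theta b}(x)}f(x)\,dx,\qquad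 v_f(a,\theta,b)=\frac{\nabla_bW_f(a,\theta,b)}{2\pi i\,W_f(a,\theta,b)}\quad(W_f(a,\theta,b)\ne0).$$ *Shape functions.* $S:\mathbb R^2\to\mathbb C$ belongs to $S_M$ if it is $(2\pi,2\pi)$-periodic, has unit $L^2([-\pi,\pi]^2)$-norm, satisfies $|S|\le M$, is the uniform limit of its Fourier series $\sum_{n\in\mathbb Z^2}\widehat S(n)e^{in\cdot x}$, where $\widehat S(n)=(2\pi)^{-2}\int_{[-\pi,\pi]^2}S(x)e^{-in\cdot x}dx$, satisfies $\sum_n|\widehat S(n)|\le M$ and $\widehat S(0)=0$, and the greatest common divisor of the absolute values of all coordinates of all $n$ with $\widehat S(n)\neq0$ is $1$. *General intrinsic mode type functions (GIMT).* Let $F$ be a real $2\times2$ matrix and $N>0$. A function $f(x)=\alpha(x)S(2\pi NF\phi(x))$ is a 2D GIMT of type $(M,N,F)$ if $S\in S_M$, $\alpha:\mathbb R^2\to\mathbb R$ and $\phi:\mathbb R^2\to\mathbb R^2$ are $C^\infty$, $|\nabla\alpha|\le M$, $1/M\le\alpha\le M$, and, with $\widetilde\phi_n=n^{\mathrm T}F\phi/|n^{\mathrm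 T}F|$, $$\tfrac1M\le|\nabla\widetilde\phi_n|\le M,\qquad |\nabla^2\widetilde\phi_n|\le M\quad\text{(operator norm of the Hessian)}\qquad\text{whenever }\widehat S(n)\ne0,$$ and moreover $|\nabla\widetilde\phi_{n-m}|\ge\tfrac1M$ whenever $n\neq m$, $\widehat S(n)\ne0$ and $\widehat S(m)\neq0$. For $r>1$, $\varepsilon>0$ define the following sets of $(a,\theta,b)\in[1,\infty)\times[0,2\pi)\times\mathbb R^2$: $$R_\varepsilon=\left\{|W_f(a,\theta,b)|\ge a^{-\frac{s+t}2}\sqrt\varepsilon,\ a\le2MNr\right\},$$ $$Z_n=\left\{\left|A_a^{-1}R_\theta^{-1}\left(a e_\theta-N\nabla(n^{\mathrm T}F\phi)(b)\right)\right|\le d,\ a\le2MNr\right\}.$$ **Theorem.** There is a constant $C>0$, depending only on $M,s,t,d$ (and the fixed $w$), such that for all $r>1$ and $\varepsilon>0$ there is $N_0>0$, depending only on $M,r,s,t,d,\varepsilon$ (and $w$), such that for every $N>N_0$, every real $2\times2$ matrix $F$ with $|n^{\mathrm T}F|\ge1$ for all $n\in\mathbb Z^2\setminus\{0\}$, and every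 2D GIMT $f(x)=\alpha(x)S(2\pi NF\phi(x))$ of type $(M,N,F)$: (i) the sets $Z_n$ with $\widehat S(n)\ne0$ are pairwise disjoint, and $R_\varepsilon\subset\bigcup_{\widehat S(n)\neq0}Z_n$; (ii) for every $n$ with $\widehat S(n)\ne0$ and every $(a,\theta,b)\in R_\varepsilon\cap Z_n$, $W_f(a,\theta,\cdot)$ is differentiable at $b$ and $$\frac{\left|v_f(a,\theta,b)-N\nabla(n^{\mathrm T}F\phi)(b)\right|}{\left|N\nabla(n^{\mathrm T}F\phi)(b)\right|}\le C\sqrt\varepsilon .$$ -/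

import Mathlib

open MeasureTheory Filter Set
open scoped FourierTransform ContDiff SchwartzMap Matrix ComplexConjugate

noncomputable section

namespace CrystalSST

/-- The plane `ℝ²` with its Euclidean norm. -/
abbrev Plane : Type := EuclideanSpace ℝ (Fin 2)

/-! ### Shape functions -/

/-- The pairing `n · x = n₁ x₁ + n₂ x₂` of an integer vector with a point of the plane. -/
def intDot (n : Fin 2 → ℤ) (x : Plane) : ℝ := ∑ i, (n i : ℝ) * x i

/-- The square `[-π, π]²`. -/
def periodSquare : Set Plane := {x | ∀ i, x i ∈ Icc (-Real.pi) Real.pi}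

/-- The Fourier coefficient `Ŝ(n) = (2π)⁻² ∫_{[-π,π]²} S(x) e^{-i n·x} dx`, so that the Fourier
series of `S` is `∑ Ŝ(n) e^{i n·x}`. -/
def fourierCoeff2 (S : Plane → ℂ) (n : Fin 2 → ℤ) : ℂ :=
  (1 / (2 * (Real.pi : ℂ)) ^ 2) *
    ∫ x in periodSquare, S x * Complex.exp (-(Complex.I * (intDot n x : ℂ)))

/-- The set of `n ∈ ℤ²` with `Ŝ(n) ≠ 0`. -/
def spectrum2 (S : Plane → ℂ) : Set (Fin 2 → ℤ) := {n | fourierCoeff2 S n ≠ 0}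

/-- The class `S_M` of two-dimensional general shape functions (complex values are allowed). -/
structure IsShapeFunction (M : ℝ) (S : Plane → ℂ) : Prop where
  periodic : ∀ (x : Plane) (i : Fin 2),
    S (x + EuclideanSpace.single i (2 * Real.pi)) = S x
  norm_two : ∫ x in periodSquare, ‖S x‖ ^ 2 = 1
  norm_sup : ∀ x, ‖S x‖ ≤ M
  /-- The Fourier series converges uniformly to `S`. -/
  series : TendstoUniformly
    (fun (A : Finset (Fin 2 → ℤ)) (x : Plane) =>
      ∑ n ∈ A, fourierCoeff2 S n * Complex.exp (Complex.I * (intDot n x : ℂ))) S atTop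
  summable : Summable fun n => ‖fourierCoeff2 S n‖
  tsum_le : ∑' n, ‖fourierCoeff2 S n‖ ≤ M
  mean_zero : fourierCoeff2 S 0 = 0
  /-- The absolute values of all the coordinates of all the `n` with `Ŝ(n) ≠ 0` have greatest
  common divisor `1`. -/
  gcd_eq_one : ∀ g : ℕ, (∀ n ∈ spectrum2 S, ∀ i, g ∣ (n i).natAbs) → g = 1

/-! ### General intrinsic mode type functions -/

/-- The row vector `nᵀ F`. -/
def rowVec (F : Matrix (Fin 2) (Fin 2) ℝ) (n : Fin 2 → ℤ) : Plane :=
  WithLp.toLp 2 ((fun i => (n i : ℝ)) ᵥ* F)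

/-- The scalar function `x ↦ nᵀ F φ(x)`. -/
def phase (F : Matrix (Fin 2) (Fin 2) ℝ) (φ : Plane → Plane) (n : Fin 2 → ℤ) (x : Plane) : ℝ :=
  inner ℝ (rowVec F n) (φ x)

/-- The normalized phase `x ↦ nᵀ F φ(x) / |nᵀ F|`. -/
def normPhase (F : Matrix (Fin 2) (Fin 2) ℝ) (φ : Plane → Plane) (n : Fin 2 → ℤ) (x : Plane) : ℝ :=
  phase F φ n x / ‖rowVec F n‖

/-- `f(x) = α(x) S(2π N F φ(x))` is a two-dimensional general intrinsic mode type function of type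
`(M, N, F)` with amplitude `α`, shape function `S` and deformation `φ`. -/
structure IsGIMT (M N : ℝ) (F : Matrix (Fin 2) (Fin 2) ℝ) (α : Plane → ℝ) (S : Plane → ℂ)
    (φ : Plane → Plane) (f : Plane → ℂ) : Prop where
  eq : ∀ x, f x = (α x : ℂ) * S ((2 * Real.pi * N) • Matrix.toEuclideanLin F (φ x))
  shape : IsShapeFunction M S
  amp_smooth : ContDiff ℝ ∞ α
  amp_grad : ∀ x, ‖gradient α x‖ ≤ M
  amp_lower : ∀ x, 1 / M ≤ α x
  amp_upper : ∀ x, α x ≤ M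
  phase_smooth : ContDiff ℝ ∞ φ
  grad_lower : ∀ n ∈ spectrum2 S, ∀ x, 1 / M ≤ ‖gradient (normPhase F φ n) x‖
  grad_upper : ∀ n ∈ spectrum2 S, ∀ x, ‖gradient (normPhase F φ n) x‖ ≤ M
  /-- The operator norm of the Hessian is bounded by `M`. -/
  hess_upper : ∀ n ∈ spectrum2 S, ∀ x, ‖fderiv ℝ (gradient (normPhase F φ n)) x‖ ≤ M
  /-- The lower gradient bound also holds for differences of two distinct frequencies of `S`;
  this is what separates the local wave vectors of different components. -/
  grad_sep : ∀ n ∈ spectrum2 S, ∀ m ∈ spectrum2 S, n ≠ m →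
    ∀ x, 1 / M ≤ ‖gradient (normPhase F φ (n - m)) x‖

/-- The local wave vector `N ∇(nᵀ F φ)(b)`. -/
def localWaveVector (N : ℝ) (F : Matrix (Fin 2) (Fin 2) ℝ) (φ : Plane → Plane) (n : Fin 2 → ℤ)
    (b : Plane) : Plane :=
  N • gradient (phase F φ n) b

/-! ### General wave packets -/

/-- The scaling matrix `A_a = diag(a^t, a^s)`. -/
def scalingMatrix (s t a : ℝ) : Matrix (Fin 2) (Fin 2) ℝ := !![a ^ t, 0; 0, a ^ s]

/-- The rotation matrix `R_θ`. -/
def rotationMatrix (θ : ℝ) : Matrix (Fin 2) (Fin 2) ℝ :=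
  !![Real.cos θ, -Real.sin θ; Real.sin θ, Real.cos θ]

/-- The unit vector `e_θ = (cos θ, sin θ)ᵀ`. -/
def unitVec (θ : ℝ) : Plane := !₂[Real.cos θ, Real.sin θ]

/-- `A_a⁻¹ R_θ⁻¹ v`. -/
def freqMap (s t a θ : ℝ) (v : Plane) : Plane :=
  Matrix.toEuclideanLin ((scalingMatrix s t a)⁻¹ * (rotationMatrix θ)⁻¹) v

/-- `A_a R_θ⁻¹ x`. -/
def spaceMap (s t a θ : ℝ) (x : Plane) : Plane :=
  Matrix.toEuclideanLin (scalingMatrix s t a * (rotationMatrix θ)⁻¹) x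

/-- `w` is a mother wave packet for the geometric parameters `s`, `t` with Fourier support radius
`d`; the Fourier transform is `ŵ(ξ) = ∫ w(x) e^{-2πi x·ξ} dx`. -/
structure IsMotherWavePacket (s t d : ℝ) (w : 𝓢(Plane, ℂ)) : Prop where
  real : ∀ ξ : Plane, (𝓕 w ξ).im = 0
  nonneg : ∀ ξ : Plane, 0 ≤ (𝓕 w ξ).re
  radial : ∀ ξ η : Plane, ‖ξ‖ = ‖η‖ → 𝓕 w ξ = 𝓕 w η
  support_eq : tsupport (fun ξ : Plane => 𝓕 w ξ) = Metric.closedBall 0 d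
  admissible : ∃ c₁ c₂ : ℝ, 0 < c₁ ∧ c₁ < c₂ ∧ ∀ ξ : Plane, 1 ≤ ‖ξ‖ →
    c₁ ≤ (∫ θ in (0 : ℝ)..(2 * Real.pi), ∫ a in Ioi (1 : ℝ),
        a ^ (-(t + s)) * ‖𝓕 w (freqMap s t a θ (ξ - a • unitVec θ))‖ ^ 2 * a) ∧
    (∫ θ in (0 : ℝ)..(2 * Real.pi), ∫ a in Ioi (1 : ℝ),
        a ^ (-(t + s)) * ‖𝓕 w (freqMap s t a θ (ξ - a • unitVec θ))‖ ^ 2 * a) ≤ c₂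

/-- The general wave packet
`w_{aθb}(x) = a^{(t+s)/2} e^{2πi a (x-b)·e_θ} w(A_a R_θ⁻¹ (x-b))`. -/
def wavePacket (s t : ℝ) (w : 𝓢(Plane, ℂ)) (a θ : ℝ) (b x : Plane) : ℂ :=
  ((a ^ ((t + s) / 2) : ℝ) : ℂ) *
    Complex.exp (2 * Real.pi * Complex.I * (a * inner ℝ (x - b) (unitVec θ) : ℝ)) *
    w (spaceMap s t a θ (x - b))

/-- The general wave packet transform `W_f(a, θ, b) = ∫ conj(w_{aθb}(x)) f(x) dx`. -/
def transform (s t : ℝ) (w : 𝓢(Plane, ℂ)) (f : Plane → ℂ) (a θ : ℝ) (b : Plane) : ℂ :=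
  ∫ x, conj (wavePacket s t w a θ b x) * f x

/-- The local wave-vector estimate `v_f = ∇_b W_f / (2πi W_f)`, a vector in `ℂ²`. -/
def waveVectorEstimate (s t : ℝ) (w : 𝓢(Plane, ℂ)) (f : Plane → ℂ) (a θ : ℝ) (b : Plane) :
    EuclideanSpace ℂ (Fin 2) :=
  WithLp.toLp 2 fun i =>
    fderiv ℝ (fun b' => transform s t w f a θ b') b (EuclideanSpace.single i 1) /
      (2 * Real.pi * Complex.I * transform s t w f a θ b)

/-- A real vector regarded as a vector in `ℂ²`. -/
def toComplex (v : Plane) : EuclideanSpace ℂ (Fin 2) := WithLp.toLp 2 fun i => (v i : ℂ)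

/-- The parameters `(a, θ, b)` with `a ∈ [1, L]`, `θ ∈ [0, 2π)`, `b ∈ ℝ²`. -/
def paramDomain (L : ℝ) : Set (ℝ × ℝ × Plane) :=
  {p | 1 ≤ p.1 ∧ p.1 ≤ L ∧ 0 ≤ p.2.1 ∧ p.2.1 < 2 * Real.pi}

/-- The set `R_ε`. -/
def setR (s t : ℝ) (w : 𝓢(Plane, ℂ)) (M N r ε : ℝ) (f : Plane → ℂ) : Set (ℝ × ℝ × Plane) :=
  {p | p ∈ paramDomain (2 * M * N * r) ∧
    p.1 ^ (-((s + t) / 2)) * √ε ≤ ‖transform s t w f p.1 p.2.1 p.2.2‖}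

/-- The set `Z_n`. -/
def setZ (s t d M N r : ℝ) (F : Matrix (Fin 2) (Fin 2) ℝ) (φ : Plane → Plane) (n : Fin 2 → ℤ) :
    Set (ℝ × ℝ × Plane) :=
  {p | p ∈ paramDomain (2 * M * N * r) ∧
    ‖freqMap s t p.1 p.2.1 (p.1 • unitVec p.2.1 - localWaveVector N F φ n p.2.2)‖ ≤ d}

end CrystalSST

end

/-!
The Fourier series of the shape function writes `f` as an absolutely convergent sum of intrinsic
modes `α(x) e^{2πiΛψ(x)}` with `Λ = N |nᵀF|`, so everything reduces to a bound on the wave packet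
coefficient of a single mode, uniform over all modes of large frequency `Λ`. Suppose that
`𝓕 w` vanishes at `A_a⁻¹ R_θ⁻¹ (κ - a e_θ)`, where `κ` is the local wave vector of the mode at `b`.

* If `a ≥ Λ / (2M)`, the packet is so concentrated that the mode may be replaced by its
  linearization at `b`, at the cost of `a^{-s} + Λ a^{-2s}`, which is small because `s > 1/2`; the
  coefficient of the linearization is the vanishing value of `𝓕 w`.
* If `a ≤ Λ / (2M)`, the phase has gradient at least `Λ / (2M)` relative to the packet, hence
  `Λ a^{-t}` after rescaling, and one integration by parts against the inverted gradient bounds the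
  coefficient by `a^t / Λ`, which is small because `t < 1`.

So a coefficient of `f` can be large only where some mode has its local wave vector in the support
of `𝓕 w` transported to `(a, θ)`. This transported support has radius at most `a^t d`, much less
than the distance, of order `N`, between the local wave vectors of two modes. Finally `∇_b` acts on
the carrier of the packet as multiplication by `2πi a e_θ` up to an error of relative size
`a^{t-1}`, so `v_f` is as close to `a e_θ`, and hence to the local wave vector, as one wishes.
-/

noncomputable section

namespace CrystalSST

open scoped RealInnerProductSpace

/-! ### Oscillatory integrals -/

theorem norm_fourierChar_sub_le (x y : ℝ) :
    ‖(𝐞 x : ℂ) - (𝐞 y : ℂ)‖ ≤ 2 * Real.pi * |x - y| := by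
  have h : (𝐞 x : ℂ) - 𝐞 y = 𝐞 y * (Complex.exp (Complex.I * (2 * Real.pi * (x - y) : ℝ)) - 1) := by
    rw [Real.fourierChar_apply, Real.fourierChar_apply, mul_sub, ← Complex.exp_add, mul_one]
    congr 2
    push_cast
    ring
  rw [h, norm_mul, Circle.norm_coe, one_mul]
  refine (Real.norm_exp_I_mul_ofReal_sub_one_le (x := 2 * Real.pi * (x - y))).trans ?_
  rw [Real.norm_eq_abs, abs_mul, abs_of_pos Real.two_pi_pos]

theorem continuous_fourierChar_comp {X : Type*} [TopologicalSpace X] {G : X → ℝ}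
    (hG : Continuous G) : Continuous fun y => (𝐞 (G y) : ℂ) :=
  continuous_subtype_val.comp (Real.continuous_fourierChar.comp hG)

section InnerProductSpace

variable {V : Type*} [NormedAddCommGroup V] [InnerProductSpace ℝ V]

theorem hasFDerivAt_fourierChar_comp {G : V → ℝ} {G' : V →L[ℝ] ℝ} {x : V}
    (hG : HasFDerivAt G G' x) :
    HasFDerivAt (fun y => (𝐞 (G y) : ℂ))
      (G'.smulRight (2 * Real.pi * Complex.I * (𝐞 (G x) : ℂ))) x :=
  (Real.hasDerivAt_fourierChar (G x)).hasFDerivAt.comp x hG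

theorem abs_sub_sub_inner_gradient_le [CompleteSpace V] {f : V → ℝ} {H : ℝ}
    (hf : Differentiable ℝ f) (hf' : Differentiable ℝ (gradient f))
    (hH : ∀ x, ‖fderiv ℝ (gradient f) x‖ ≤ H) (x z : V) :
    |f (x + z) - f x - ⟪gradient f x, z⟫| ≤ H * ‖z‖ ^ 2 := by
  have hH0 : 0 ≤ H := (norm_nonneg _).trans (hH x)
  have hder : ∀ y, HasFDerivAt (fun y => f (x + y) - ⟪gradient f x, y⟫)
      (innerSL ℝ (gradient f (x + y) - gradient f x)) y := fun y => by
    have h₁ := ((hf (x + y)).hasGradientAt.hasFDerivAt.comp y ((hasFDerivAt_id y).const_add x))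
    convert! h₁.sub (innerSL ℝ (gradient f x)).hasFDerivAt using 1
    ext v
    simp
  have hbound : ∀ y ∈ Metric.closedBall (0 : V) ‖z‖,
      ‖innerSL ℝ (gradient f (x + y) - gradient f x)‖ ≤ H * ‖z‖ := fun y hy => by
    rw [innerSL_apply_norm]
    calc ‖gradient f (x + y) - gradient f x‖ ≤ H * ‖x + y - x‖ :=
          convex_univ.norm_image_sub_le_of_norm_fderiv_le (fun u _ => hf' u) (fun u _ => hH u)
            (mem_univ _) (mem_univ _)
      _ ≤ H * ‖z‖ := by
          rw [add_sub_cancel_left]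
          exact mul_le_mul_of_nonneg_left (mem_closedBall_zero_iff.1 hy) hH0
  have hmean := (convex_closedBall (0 : V) ‖z‖).norm_image_sub_le_of_norm_hasFDerivWithin_le
    (fun y _ => (hder y).hasFDerivWithinAt) hbound (Metric.mem_closedBall_self (norm_nonneg z))
    (mem_closedBall_zero_iff.2 le_rfl)
  simpa [sub_right_comm, mul_assoc, sq] using hmean

open EuclideanGeometry in
theorem norm_fderiv_inversion_comp_le {Γ : V → V} {H K : ℝ} {x : V}
    (hΓ : DifferentiableAt ℝ Γ x) (hH : ‖fderiv ℝ Γ x‖ ≤ H) (hK : 0 < K) (hKx : K ≤ ‖Γ x‖) :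
    DifferentiableAt ℝ (fun y => inversion 0 1 (Γ y)) x ∧
      ‖fderiv ℝ (fun y => inversion 0 1 (Γ y)) x‖ ≤ H / K ^ 2 := by
  have hne : Γ x ≠ 0 := norm_pos_iff.1 (hK.trans_le hKx)
  have h := (hasFDerivAt_inversion (R := 1) hne).comp x hΓ.hasFDerivAt
  refine ⟨h.differentiableAt, ?_⟩
  rw [show (fun y => inversion 0 1 (Γ y)) = inversion 0 1 ∘ Γ from rfl, h.fderiv]
  refine (ContinuousLinearMap.opNorm_comp_le _ _).trans ?_
  rw [norm_smul, norm_pow, dist_zero_right, norm_div, norm_one, norm_norm]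
  calc (1 / ‖Γ x‖) ^ 2 * ‖_‖ * ‖fderiv ℝ Γ x‖ ≤ (1 / K) ^ 2 * 1 * H := by
        gcongr
        exact LinearIsometry.norm_toContinuousLinearMap_le _
    _ = H / K ^ 2 := by ring

theorem norm_fderiv_mul_inner_apply_le {u : V → ℂ} {T : V → V} {A B : ℝ} {e x : V}
    (he : ‖e‖ ≤ 1) (hu : DifferentiableAt ℝ u x) (hT : DifferentiableAt ℝ T x) (hA : ‖T x‖ ≤ A)
    (hB : ‖fderiv ℝ T x‖ ≤ B) :
    ‖fderiv ℝ (fun y => u y * (⟪T y, e⟫ : ℂ)) x e‖ ≤ A * ‖fderiv ℝ u x‖ + B * ‖u x‖ := by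
  have hder : HasFDerivAt (fun y => u y * (⟪T y, e⟫ : ℂ)) _ x :=
    hu.hasFDerivAt.mul (Complex.ofRealCLM.hasFDerivAt.comp x
      (hT.hasFDerivAt.inner ℝ (hasFDerivAt_const e x)))
  have hTe : |⟪T x, e⟫| ≤ A :=
    (abs_real_inner_le_norm _ _).trans ((mul_le_of_le_one_right (norm_nonneg _) he).trans hA)
  have hue : ‖fderiv ℝ u x e‖ ≤ ‖fderiv ℝ u x‖ := (fderiv ℝ u x).unit_le_opNorm e he
  have hTe' : |⟪fderiv ℝ T x e, e⟫| ≤ B :=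
    (abs_real_inner_le_norm _ _).trans ((mul_le_of_le_one_right (norm_nonneg _) he).trans
      (((fderiv ℝ T x).unit_le_opNorm e he).trans hB))
  have hval : fderiv ℝ (fun y => u y * (⟪T y, e⟫ : ℂ)) x e =
      ⟪T x, e⟫ * fderiv ℝ u x e + ⟪fderiv ℝ T x e, e⟫ * u x := by
    rw [hder.fderiv]
    simp [mul_comm, add_comm]
  rw [hval]
  refine (norm_add_le _ _).trans ?_
  rw [norm_mul, norm_mul, Complex.norm_real, Complex.norm_real]
  exact add_le_add (mul_le_mul hTe hue (norm_nonneg _) ((abs_nonneg _).trans hTe))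
    (mul_le_mul_of_nonneg_right hTe' (norm_nonneg _))

section Integral

variable [FiniteDimensional ℝ V] [MeasurableSpace V] [BorelSpace V]

theorem integrable_mul_fourierChar {f : V → ℂ} {G : V → ℝ} (hf : Integrable f)
    (hG : Continuous G) : Integrable fun x => f x * (𝐞 (G x) : ℂ) :=
  hf.mul_bdd (c := 1) (continuous_fourierChar_comp hG).aestronglyMeasurable
    (ae_of_all _ fun _ => (Circle.norm_coe _).le)

theorem norm_integral_mul_fderiv_mul_fourierChar_le {f : V → ℂ} {G : V → ℝ} {v : V}
    (hf : Differentiable ℝ f) (hG : Differentiable ℝ G) (hfi : Integrable f)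
    (hf' : Integrable fun x => fderiv ℝ f x v)
    (hfG : Integrable fun x => f x * (fderiv ℝ G x v : ℂ)) :
    2 * Real.pi * ‖∫ x, f x * (fderiv ℝ G x v : ℂ) * (𝐞 (G x) : ℂ)‖ ≤ ∫ x, ‖fderiv ℝ f x v‖ := by
  have he : ∀ x, HasFDerivAt (fun y => (𝐞 (G y) : ℂ)) _ x := fun x =>
    hasFDerivAt_fourierChar_comp (hG x).hasFDerivAt
  have he' : ∀ x, f x * fderiv ℝ (fun y => (𝐞 (G y) : ℂ)) x v =
      2 * Real.pi * Complex.I * (f x * (fderiv ℝ G x v : ℂ) * (𝐞 (G x) : ℂ)) := fun x => by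
    rw [(he x).fderiv, ContinuousLinearMap.smulRight_apply, Complex.real_smul]
    ring
  have hparts := integral_mul_fderiv_eq_neg_fderiv_mul_of_integrable
    (integrable_mul_fourierChar hf' hG.continuous)
    (by simpa only [he'] using (integrable_mul_fourierChar hfG hG.continuous).const_mul _)
    (integrable_mul_fourierChar hfi hG.continuous) (fun x _ => hf x)
    (fun x _ => (he x).differentiableAt)
  simp only [he', integral_const_mul] at hparts
  calc 2 * Real.pi * ‖∫ x, f x * (fderiv ℝ G x v : ℂ) * (𝐞 (G x) : ℂ)‖
      = ‖∫ x, fderiv ℝ f x v * (𝐞 (G x) : ℂ)‖ := by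
        rw [← norm_neg (∫ x, fderiv ℝ f x v * _), ← hparts]
        simp [abs_of_pos Real.pi_pos]
    _ ≤ ∫ x, ‖fderiv ℝ f x v * (𝐞 (G x) : ℂ)‖ := norm_integral_le_integral_norm _
    _ = ∫ x, ‖fderiv ℝ f x v‖ := by simp only [norm_mul, Circle.norm_coe, mul_one]

theorem integrable_mul_inner_mul_fderiv {u : V → ℂ} {G : V → ℝ} {T : V → V} {C : ℝ} {e : V}
    (he : ‖e‖ ≤ 1) (hui : Integrable u) (hT : Continuous T)
    (hC : ∀ x, ‖T x‖ * ‖fderiv ℝ G x‖ ≤ C) :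
    Integrable fun x => u x * (⟪T x, e⟫ : ℂ) * (fderiv ℝ G x e : ℂ) := by
  have hTm : AEStronglyMeasurable fun x => (⟪T x, e⟫ : ℂ) :=
    Continuous.aestronglyMeasurable (by fun_prop)
  have hGm : AEStronglyMeasurable fun x => (fderiv ℝ G x e : ℂ) :=
    (measurable_fderiv_apply_const ℝ G e).complex_ofReal.aestronglyMeasurable
  simp only [mul_assoc]
  refine hui.mul_bdd (c := C) (hTm.mul hGm) (ae_of_all _ fun x => ?_)
  rw [norm_mul, Complex.norm_real, Complex.norm_real]
  refine le_trans ?_ (hC x)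
  gcongr
  · exact (norm_inner_le_norm _ _).trans (mul_le_of_le_one_right (norm_nonneg _) he)
  · exact (fderiv ℝ G x).unit_le_opNorm e he

theorem norm_integral_mul_inner_mul_fderiv_mul_fourierChar_le {u : V → ℂ} {G : V → ℝ}
    {T : V → V} {A B C : ℝ} {e : V} (he : ‖e‖ ≤ 1) (hu : Differentiable ℝ u)
    (hui : Integrable u) (hu' : Integrable (fderiv ℝ u)) (hG : Differentiable ℝ G)
    (hT : Differentiable ℝ T) (hA : ∀ x, ‖T x‖ ≤ A) (hB : ∀ x, ‖fderiv ℝ T x‖ ≤ B)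
    (hC : ∀ x, ‖T x‖ * ‖fderiv ℝ G x‖ ≤ C) :
    2 * Real.pi * ‖∫ x, u x * (⟪T x, e⟫ : ℂ) * (fderiv ℝ G x e : ℂ) * (𝐞 (G x) : ℂ)‖ ≤
      A * (∫ x, ‖fderiv ℝ u x‖) + B * ∫ x, ‖u x‖ := by
  have hf' : ∀ x, ‖fderiv ℝ (fun y => u y * (⟪T y, e⟫ : ℂ)) x e‖ ≤
      A * ‖fderiv ℝ u x‖ + B * ‖u x‖ := fun x =>
    norm_fderiv_mul_inner_apply_le he (hu x) (hT x) (hA x) (hB x)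
  have hmaj : Integrable fun x => A * ‖fderiv ℝ u x‖ + B * ‖u x‖ :=
    (hu'.norm.const_mul A).add (hui.norm.const_mul B)
  have hfi' := hmaj.mono' (measurable_fderiv_apply_const ℝ _ e).aestronglyMeasurable
    (ae_of_all _ hf')
  have hfi : Integrable fun x => u x * (⟪T x, e⟫ : ℂ) :=
    hui.mul_bdd (c := A) (by have := hT.continuous; fun_prop) (ae_of_all _ fun x => by
      rw [Complex.norm_real]
      exact (norm_inner_le_norm _ _).trans
        ((mul_le_of_le_one_right (norm_nonneg _) he).trans (hA x)))
  rw [← integral_const_mul, ← integral_const_mul,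
    ← integral_add (hu'.norm.const_mul A) (hui.norm.const_mul B)]
  exact (norm_integral_mul_fderiv_mul_fourierChar_le
    (hu.mul (Complex.ofRealCLM.differentiable.comp (hT.inner ℝ (differentiable_const e)))) hG hfi
    hfi' (integrable_mul_inner_mul_fderiv he hui hT.continuous hC)).trans
    (integral_mono hfi'.norm hmaj hf')

theorem norm_integral_mul_fourierChar_le_of_fderiv_apply_eq_one {u : V → ℂ} {G : V → ℝ}
    {T : V → V} {A B C : ℝ} (hu : Differentiable ℝ u) (hui : Integrable u)
    (hu' : Integrable (fderiv ℝ u)) (hG : Differentiable ℝ G) (hT : Differentiable ℝ T)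
    (hA : ∀ x, ‖T x‖ ≤ A) (hB : ∀ x, ‖fderiv ℝ T x‖ ≤ B) (hC : ∀ x, ‖T x‖ * ‖fderiv ℝ G x‖ ≤ C)
    (hTG : ∀ x, fderiv ℝ G x (T x) = 1) :
    2 * Real.pi * ‖∫ x, u x * (𝐞 (G x) : ℂ)‖ ≤
      Module.finrank ℝ V * (A * (∫ x, ‖fderiv ℝ u x‖) + B * ∫ x, ‖u x‖) := by
  let e := stdOrthonormalBasis ℝ V
  have he i : ‖e i‖ ≤ 1 := (e.norm_eq_one i).le
  have hint i : Integrable fun x =>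
      u x * (⟪T x, e i⟫ : ℂ) * (fderiv ℝ G x (e i) : ℂ) * (𝐞 (G x) : ℂ) :=
    integrable_mul_fourierChar (integrable_mul_inner_mul_fderiv (he i) hui hT.continuous hC)
      hG.continuous
  have hone : ∀ x, ∑ i, ⟪T x, e i⟫ * fderiv ℝ G x (e i) = 1 := fun x => by
    rw [← hTG x]
    conv_rhs => rw [← e.sum_repr' (T x)]
    simp [real_inner_comm]
  have hsum : ∀ x, u x * (𝐞 (G x) : ℂ) =
      ∑ i, u x * (⟪T x, e i⟫ : ℂ) * (fderiv ℝ G x (e i) : ℂ) * (𝐞 (G x) : ℂ) := fun x => by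
    have := congrArg (fun c : ℝ => u x * (c : ℂ) * (𝐞 (G x) : ℂ)) (hone x)
    simpa [Finset.mul_sum, Finset.sum_mul, mul_assoc] using this.symm
  calc 2 * Real.pi * ‖∫ x, u x * (𝐞 (G x) : ℂ)‖
      ≤ 2 * Real.pi * ∑ i,
          ‖∫ x, u x * (⟪T x, e i⟫ : ℂ) * (fderiv ℝ G x (e i) : ℂ) * (𝐞 (G x) : ℂ)‖ := by
        simp only [hsum]
        rw [integral_finsetSum _ fun i _ => hint i]
        gcongr
        exact norm_sum_le _ _
    _ ≤ ∑ _i : Fin (Module.finrank ℝ V), (A * (∫ x, ‖fderiv ℝ u x‖) + B * ∫ x, ‖u x‖) := by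
        rw [Finset.mul_sum]
        exact Finset.sum_le_sum fun i _ =>
          norm_integral_mul_inner_mul_fderiv_mul_fourierChar_le (he i) hu hui hu' hG hT hA hB hC
    _ = _ := by rw [Finset.sum_const, Finset.card_fin, nsmul_eq_mul]

theorem norm_integral_mul_fourierChar_le {u : V → ℂ} {G : V → ℝ} {H K : ℝ}
    (hu : Differentiable ℝ u) (hui : Integrable u) (hu' : Integrable (fderiv ℝ u))
    (hG : Differentiable ℝ G) (hG' : Differentiable ℝ (gradient G))
    (hH : ∀ x, ‖fderiv ℝ (gradient G) x‖ ≤ H) (hK : 0 < K) (hKG : ∀ x, K ≤ ‖gradient G x‖) :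
    2 * Real.pi * ‖∫ x, u x * (𝐞 (G x) : ℂ)‖ ≤
      Module.finrank ℝ V * (K⁻¹ * (∫ x, ‖fderiv ℝ u x‖) + H / K ^ 2 * ∫ x, ‖u x‖) := by
  have hpos : ∀ x, 0 < ‖gradient G x‖ := fun x => hK.trans_le (hKG x)
  have hT : ∀ x, ‖EuclideanGeometry.inversion 0 1 (gradient G x)‖ = ‖gradient G x‖⁻¹ := fun x => by
    rw [← dist_zero_right, EuclideanGeometry.dist_inversion_center, dist_zero_right, one_pow,
      one_div]
  have hT' := fun x => norm_fderiv_inversion_comp_le (hG' x) (hH x) hK (hKG x)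
  refine norm_integral_mul_fourierChar_le_of_fderiv_apply_eq_one hu hui hu' hG
    (T := fun x => EuclideanGeometry.inversion 0 1 (gradient G x)) (C := 1)
    (fun x => (hT' x).1) (fun x => ?_) (fun x => (hT' x).2) (fun x => ?_) fun x => ?_
  · exact (hT x).trans_le (inv_anti₀ hK (hKG x))
  · rw [hT, gradient, LinearIsometryEquiv.norm_map]
    exact inv_mul_le_one
  · rw [← inner_gradient_left, EuclideanGeometry.inversion]
    simp only [dist_zero_right, vsub_eq_sub, sub_zero, vadd_eq_add, add_zero,
      real_inner_smul_right, real_inner_self_eq_norm_sq]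
    rw [← mul_pow, one_div_mul_cancel (hpos x).ne', one_pow]

end Integral

end InnerProductSpace

/-! ### Wave packet coefficients of intrinsic modes -/

/-- The intrinsic mode `α(x) e^{2πiΨ(x)}` with amplitude `α` and phase `Ψ`. -/
def intrinsicMode {X : Type*} (α Ψ : X → ℝ) (x : X) : ℂ := (α x : ℂ) * (𝐞 (Ψ x) : ℂ)

theorem norm_intrinsicMode {X : Type*} (α Ψ : X → ℝ) (x : X) : ‖intrinsicMode α Ψ x‖ = |α x| := by
  rw [intrinsicMode, norm_mul, Circle.norm_coe, mul_one, Complex.norm_real, Real.norm_eq_abs]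

theorem continuous_intrinsicMode {X : Type*} [TopologicalSpace X] {α Ψ : X → ℝ}
    (hα : Continuous α) (hΨ : Continuous Ψ) : Continuous (intrinsicMode α Ψ) :=
  (Complex.continuous_ofReal.comp hα).mul (continuous_fourierChar_comp hΨ)

section IntrinsicMode

variable {V : Type*} [NormedAddCommGroup V] [InnerProductSpace ℝ V] [CompleteSpace V]

/-- `α` and `Ψ` are the amplitude and the phase of an intrinsic mode of frequency `Λ`: relative to
`M`, the amplitude is bounded with bounded derivative, and the phase is `Λ` times a function with
bounded Hessian whose gradient stays away from `0`. -/
structure IsIntrinsicMode (M Λ : ℝ) (α Ψ : V → ℝ) : Prop where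
  amp_differentiable : Differentiable ℝ α
  abs_amp_le : ∀ x, |α x| ≤ M
  norm_fderiv_amp_le : ∀ x, ‖fderiv ℝ α x‖ ≤ M
  phase_differentiable : Differentiable ℝ Ψ
  gradient_differentiable : Differentiable ℝ (gradient Ψ)
  norm_fderiv_gradient_le : ∀ x, ‖fderiv ℝ (gradient Ψ) x‖ ≤ Λ * M
  le_norm_gradient : ∀ x, Λ / M ≤ ‖gradient Ψ x‖

namespace IsIntrinsicMode

variable {M Λ : ℝ} {α Ψ : V → ℝ}

theorem continuous (h : IsIntrinsicMode M Λ α Ψ) : Continuous (intrinsicMode α Ψ) :=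
  continuous_intrinsicMode h.amp_differentiable.continuous h.phase_differentiable.continuous

theorem norm_sub_linear_le (h : IsIntrinsicMode M Λ α Ψ) (x z : V) :
    ‖intrinsicMode α Ψ (x + z) - (α x : ℂ) * (𝐞 (Ψ x + ⟪gradient Ψ x, z⟫) : ℂ)‖ ≤
      M * ‖z‖ + M * (2 * Real.pi * (Λ * M * ‖z‖ ^ 2)) := by
  have hamp : |α (x + z) - α x| ≤ M * ‖z‖ := by
    simpa using convex_univ.norm_image_sub_le_of_norm_fderiv_le
      (fun y _ => h.amp_differentiable y) (fun y _ => h.norm_fderiv_amp_le y) (mem_univ x)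
      (mem_univ (x + z))
  have hphase : ‖(𝐞 (Ψ (x + z)) : ℂ) - (𝐞 (Ψ x + ⟪gradient Ψ x, z⟫) : ℂ)‖ ≤
      2 * Real.pi * (Λ * M * ‖z‖ ^ 2) := by
    refine (norm_fourierChar_sub_le _ _).trans ?_
    gcongr
    rw [← sub_sub]
    exact abs_sub_sub_inner_gradient_le h.phase_differentiable h.gradient_differentiable
      h.norm_fderiv_gradient_le x z
  have hsplit : intrinsicMode α Ψ (x + z) - (α x : ℂ) * (𝐞 (Ψ x + ⟪gradient Ψ x, z⟫) : ℂ) =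
      ((α (x + z) - α x : ℝ) : ℂ) * (𝐞 (Ψ (x + z)) : ℂ) +
        (α x : ℂ) * ((𝐞 (Ψ (x + z)) : ℂ) - (𝐞 (Ψ x + ⟪gradient Ψ x, z⟫) : ℂ)) := by
    rw [intrinsicMode]
    push_cast
    ring
  rw [hsplit]
  refine (norm_add_le _ _).trans (add_le_add ?_ ?_)
  · rwa [norm_mul, Circle.norm_coe, mul_one, Complex.norm_real]
  · rw [norm_mul, Complex.norm_real]
    exact mul_le_mul (h.abs_amp_le x) hphase (norm_nonneg _) ((abs_nonneg _).trans (h.abs_amp_le x))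

theorem differentiable_mul_amp (h : IsIntrinsicMode M Λ α Ψ) {k : V → ℂ}
    (hk : Differentiable ℝ k) (B : V →L[ℝ] V) (b : V) :
    Differentiable ℝ fun y => k y * (α (b + B y) : ℂ) :=
  hk.mul (Complex.ofRealCLM.differentiable.comp
    (h.amp_differentiable.comp (B.differentiable.const_add b)))

theorem norm_fderiv_mul_amp_le (h : IsIntrinsicMode M Λ α Ψ) {k : V → ℂ} {y : V}
    (hk : DifferentiableAt ℝ k y) (B : V →L[ℝ] V) (b : V) :
    ‖fderiv ℝ (fun y => k y * (α (b + B y) : ℂ)) y‖ ≤ M * ‖fderiv ℝ k y‖ + M * ‖B‖ * ‖k y‖ := by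
  have hαB : HasFDerivAt (fun y => α (b + B y)) (fderiv ℝ α (b + B y) ∘L B) y :=
    (h.amp_differentiable _).hasFDerivAt.comp y (B.hasFDerivAt.const_add b)
  have hder : HasFDerivAt (fun y => k y * (α (b + B y) : ℂ)) _ y :=
    hk.hasFDerivAt.mul (Complex.ofRealCLM.hasFDerivAt.comp y hαB)
  have hαB' : ‖Complex.ofRealCLM ∘L fderiv ℝ α (b + B y) ∘L B‖ ≤ M * ‖B‖ := by
    refine (ContinuousLinearMap.opNorm_comp_le _ _).trans ?_
    rw [Complex.ofRealCLM_norm, one_mul]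
    exact (ContinuousLinearMap.opNorm_comp_le _ _).trans
      (mul_le_mul_of_nonneg_right (h.norm_fderiv_amp_le _) (norm_nonneg _))
  rw [hder.fderiv, add_comm (M * _)]
  refine (norm_add_le _ _).trans ?_
  rw [norm_smul, norm_smul, Complex.norm_real, mul_comm ‖k y‖]
  exact add_le_add (mul_le_mul_of_nonneg_right hαB' (norm_nonneg _))
    (mul_le_mul_of_nonneg_right (h.abs_amp_le _) (norm_nonneg _))

end IsIntrinsicMode

open ContinuousLinearMap (adjoint)

theorem hasGradientAt_comp_add_sub_inner {Ψ : V → ℝ} (hΨ : Differentiable ℝ Ψ) (B : V →L[ℝ] V)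
    (κ b y : V) :
    HasGradientAt (fun y => Ψ (b + B y) - ⟪κ, B y⟫) (adjoint B (gradient Ψ (b + B y) - κ)) y := by
  have hB := B.hasFDerivAt (x := y)
  rw [hasGradientAt_iff_hasFDerivAt]
  convert! ((hΨ _).hasGradientAt.hasFDerivAt.comp y (hB.const_add b)).sub
    ((innerSL ℝ κ).hasFDerivAt.comp y hB) using 1
  ext v
  simp [ContinuousLinearMap.adjoint_inner_left]

theorem gradient_comp_add_sub_inner {Ψ : V → ℝ} (hΨ : Differentiable ℝ Ψ) (B : V →L[ℝ] V)
    (κ b : V) :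
    gradient (fun y => Ψ (b + B y) - ⟪κ, B y⟫) =
      fun y => adjoint B (gradient Ψ (b + B y) - κ) :=
  funext fun y => (hasGradientAt_comp_add_sub_inner hΨ B κ b y).gradient

theorem hasFDerivAt_adjoint_gradient_comp {Ψ : V → ℝ} (hΨ : Differentiable ℝ (gradient Ψ))
    (B : V →L[ℝ] V) (κ b y : V) :
    HasFDerivAt (fun y => adjoint B (gradient Ψ (b + B y) - κ))
      (adjoint B ∘L fderiv ℝ (gradient Ψ) (b + B y) ∘L B) y :=
  (adjoint B).hasFDerivAt.comp y
    (((hΨ _).hasFDerivAt.comp y (B.hasFDerivAt.const_add b)).sub_const κ)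

theorem norm_adjoint_comp_comp_le (B A : V →L[ℝ] V) :
    ‖adjoint B ∘L A ∘L B‖ ≤ ‖A‖ * ‖B‖ ^ 2 := by
  calc ‖adjoint B ∘L A ∘L B‖ ≤ ‖adjoint B‖ * (‖A‖ * ‖B‖) :=
        (ContinuousLinearMap.opNorm_comp_le _ _).trans
          (mul_le_mul_of_nonneg_left (ContinuousLinearMap.opNorm_comp_le _ _) (norm_nonneg _))
    _ = ‖A‖ * ‖B‖ ^ 2 := by
        rw [LinearIsometryEquiv.norm_map]
        ring

end IntrinsicMode

section Packet

variable {V : Type*} [NormedAddCommGroup V] [InnerProductSpace ℝ V] [FiniteDimensional ℝ V]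
  [MeasurableSpace V] [BorelSpace V]

/-- The coefficient at the position `b` of `f` against the wave packet of wave vector `κ` and
profile `k`: up to a normalization it is the integral of `f` against
`x ↦ k(B⁻¹(x - b)) e^{-2πi κ·(x - b)}`, written in the variable `y = B⁻¹(x - b)`. -/
def packetIntegral (k : 𝓢(V, ℂ)) (B : V →L[ℝ] V) (κ : V) (f : V → ℂ) (b : V) : ℂ :=
  ∫ y, k y * ((𝐞 (-⟪κ, B y⟫) : ℂ) * f (b + B y))

variable (k : 𝓢(V, ℂ)) (B : V →L[ℝ] V) (κ b : V)

theorem integrable_packetIntegral {f : V → ℂ} {C : ℝ} (hf : Continuous f)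
    (hC : ∀ x, ‖f x‖ ≤ C) :
    Integrable fun y => k y * ((𝐞 (-⟪κ, B y⟫) : ℂ) * f (b + B y)) := by
  refine k.integrable.mul_bdd (c := C) ?_ (ae_of_all _ fun y => ?_)
  · exact ((continuous_fourierChar_comp (by fun_prop)).mul (by fun_prop)).aestronglyMeasurable
  · rw [norm_mul, Circle.norm_coe, one_mul]
    exact hC _

theorem packetIntegral_const_mul (c : ℂ) (f : V → ℂ) :
    packetIntegral k B κ (fun x => c * f x) b = c * packetIntegral k B κ f b := by
  simp only [packetIntegral, mul_left_comm _ c, integral_const_mul]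

theorem hasSum_packetIntegral {ι : Type*} [Countable ι] {f : V → ℂ} {g : ι → V → ℂ} {c : ι → ℝ}
    (hg : ∀ i, Continuous (g i)) (hc : Summable c) (hgc : ∀ i x, ‖g i x‖ ≤ c i)
    (hf : ∀ x, HasSum (fun i => g i x) (f x)) :
    HasSum (fun i => packetIntegral k B κ (g i) b) (packetIntegral k B κ f b) := by
  refine hasSum_integral_of_dominated_convergence (fun i y => ‖k y‖ * c i)
    (fun i => (integrable_packetIntegral k B κ b (hg i) (hgc i)).aestronglyMeasurable)
    (fun i => ae_of_all _ fun y => ?_) (ae_of_all _ fun y => hc.mul_left _) ?_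
    (ae_of_all _ fun y => ((hf _).mul_left _).mul_left _)
  · rw [norm_mul, norm_mul, Circle.norm_coe, one_mul]
    exact mul_le_mul_of_nonneg_left (hgc i _) (norm_nonneg _)
  · simp only [tsum_mul_left]
    exact k.integrable.norm.mul_const _

open ContinuousLinearMap (adjoint)

theorem integral_mul_fourierChar_eq_fourierInv (v : V) :
    ∫ y, k y * (𝐞 ⟪v, y⟫ : ℂ) = 𝓕⁻ k v := by
  rw [SchwartzMap.fourierInv_coe, Real.fourierInv_eq]
  simp only [Circle.smul_def, smul_eq_mul, mul_comm, real_inner_comm]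

theorem IsIntrinsicMode.norm_packetIntegral_sub_le {M Λ : ℝ} {α Ψ : V → ℝ}
    (h : IsIntrinsicMode M Λ α Ψ) :
    ‖packetIntegral k B κ (intrinsicMode α Ψ) b -
        intrinsicMode α Ψ b * 𝓕⁻ k (adjoint B (gradient Ψ b - κ))‖ ≤
      M * ‖B‖ * (∫ y, ‖y‖ ^ 1 * ‖k y‖) +
        M * (2 * Real.pi * (Λ * M * ‖B‖ ^ 2)) * ∫ y, ‖y‖ ^ 2 * ‖k y‖ := by
  have hlinear : intrinsicMode α Ψ b * 𝓕⁻ k (adjoint B (gradient Ψ b - κ)) =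
      packetIntegral k B κ
        (fun x => (α b : ℂ) * (𝐞 (Ψ b + ⟪gradient Ψ b, x - b⟫) : ℂ)) b := by
    rw [← integral_mul_fourierChar_eq_fourierInv, ← integral_const_mul, packetIntegral]
    congr 1 with y
    rw [intrinsicMode, add_sub_cancel_left, ContinuousLinearMap.adjoint_inner_left,
      inner_sub_left, sub_eq_add_neg, AddChar.map_add_eq_mul, AddChar.map_add_eq_mul,
      Circle.coe_mul, Circle.coe_mul]
    ring
  have hint₁ := integrable_packetIntegral k B κ b h.continuous fun x =>
    (norm_intrinsicMode α Ψ x).trans_le (h.abs_amp_le x)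
  have hint₂ := integrable_packetIntegral k B κ b
    (f := fun x => (α b : ℂ) * (𝐞 (Ψ b + ⟪gradient Ψ b, x - b⟫) : ℂ)) (C := M)
    (continuous_const.mul (continuous_fourierChar_comp (by fun_prop))) fun x => by
      rw [norm_mul, Circle.norm_coe, mul_one, Complex.norm_real]
      exact h.abs_amp_le b
  have hint₃ := (k.integrable_pow_mul volume 1).const_mul (M * ‖B‖)
  have hint₄ := (k.integrable_pow_mul volume 2).const_mul
    (M * (2 * Real.pi * (Λ * M * ‖B‖ ^ 2)))
  rw [hlinear, packetIntegral, packetIntegral, ← integral_sub hint₁ hint₂, ← integral_const_mul,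
    ← integral_const_mul, ← integral_add hint₃ hint₄]
  refine norm_integral_le_of_norm_le (hint₃.add hint₄) (ae_of_all _ fun y => ?_)
  have hM : 0 ≤ M := (abs_nonneg _).trans (h.abs_amp_le b)
  have hΛM : 0 ≤ Λ * M := (norm_nonneg _).trans (h.norm_fderiv_gradient_le b)
  rw [← mul_sub, ← mul_sub, norm_mul, norm_mul, Circle.norm_coe, one_mul, add_sub_cancel_left]
  calc ‖k y‖ * _ ≤ ‖k y‖ * (M * (‖B‖ * ‖y‖) + M * (2 * Real.pi * (Λ * M * (‖B‖ * ‖y‖) ^ 2))) := by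
        gcongr
        refine (h.norm_sub_linear_le b (B y)).trans ?_
        gcongr <;> exact B.le_opNorm y
    _ = _ := by ring

theorem packetIntegral_intrinsicMode (α Ψ : V → ℝ) :
    packetIntegral k B κ (intrinsicMode α Ψ) b =
      ∫ y, k y * (α (b + B y) : ℂ) * (𝐞 (Ψ (b + B y) - ⟪κ, B y⟫) : ℂ) := by
  rw [packetIntegral]
  congr 1 with y
  rw [intrinsicMode, sub_eq_neg_add, AddChar.map_add_eq_mul, Circle.coe_mul]
  ring

theorem IsIntrinsicMode.norm_packetIntegral_le {M Λ K : ℝ} {α Ψ : V → ℝ}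
    (h : IsIntrinsicMode M Λ α Ψ) (hK0 : 0 < K)
    (hK : ∀ x, K ≤ ‖adjoint B (gradient Ψ x - κ)‖) :
    2 * Real.pi * ‖packetIntegral k B κ (intrinsicMode α Ψ) b‖ ≤
      Module.finrank ℝ V * (K⁻¹ * (M * (∫ y, ‖fderiv ℝ k y‖) + M * ‖B‖ * ∫ y, ‖k y‖) +
        Λ * M * ‖B‖ ^ 2 / K ^ 2 * (M * ∫ y, ‖k y‖)) := by
  have hΛM : 0 ≤ Λ * M := (norm_nonneg _).trans (h.norm_fderiv_gradient_le b)
  let u : V → ℂ := fun y => k y * (α (b + B y) : ℂ)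
  let G : V → ℝ := fun y => Ψ (b + B y) - ⟪κ, B y⟫
  have hk' : Integrable fun y => ‖fderiv ℝ k y‖ := (SchwartzMap.fderivCLM ℝ V ℂ k).integrable.norm
  have hu : Differentiable ℝ u := h.differentiable_mul_amp k.differentiable B b
  have hu_le : ∀ y, ‖u y‖ ≤ M * ‖k y‖ := fun y => by
    rw [norm_mul, Complex.norm_real, mul_comm]
    exact mul_le_mul_of_nonneg_right (h.abs_amp_le _) (norm_nonneg _)
  have hu'_le : ∀ y, ‖fderiv ℝ u y‖ ≤ M * ‖fderiv ℝ k y‖ + M * ‖B‖ * ‖k y‖ := fun y =>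
    h.norm_fderiv_mul_amp_le k.differentiableAt B b
  have hmaj : Integrable fun y => M * ‖k y‖ := k.integrable.norm.const_mul M
  have hmaj' := (hk'.const_mul M).add (k.integrable.norm.const_mul (M * ‖B‖))
  have hui : Integrable u := hmaj.mono' hu.continuous.aestronglyMeasurable (ae_of_all _ hu_le)
  have hu' : Integrable (fderiv ℝ u) :=
    hmaj'.mono' (measurable_fderiv ℝ u).aestronglyMeasurable (ae_of_all _ hu'_le)
  have hG y : HasGradientAt G _ y := hasGradientAt_comp_add_sub_inner h.phase_differentiable B κ b y
  have hG' : gradient G = _ := gradient_comp_add_sub_inner h.phase_differentiable B κ b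
  have hG'' := hasFDerivAt_adjoint_gradient_comp h.gradient_differentiable B κ b
  have hH : ∀ y, ‖fderiv ℝ (gradient G) y‖ ≤ Λ * M * ‖B‖ ^ 2 := fun y => by
    rw [hG', (hG'' y).fderiv]
    exact (norm_adjoint_comp_comp_le _ _).trans
      (mul_le_mul_of_nonneg_right (h.norm_fderiv_gradient_le _) (sq_nonneg _))
  rw [packetIntegral_intrinsicMode, ← integral_const_mul, ← integral_const_mul,
    ← integral_const_mul, ← integral_add (hk'.const_mul M) (k.integrable.norm.const_mul (M * ‖B‖))]
  refine (norm_integral_mul_fourierChar_le hu hui hu' (fun y => (hG y).differentiableAt)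
    (hG' ▸ fun y => (hG'' y).differentiableAt) hH hK0
    fun y => (hK _).trans_eq (by rw [hG'])).trans ?_
  gcongr ?_ * (_ * ?_ + _ * ?_)
  · exact integral_mono hu'.norm hmaj' hu'_le
  · exact integral_mono hui.norm hmaj hu_le

theorem exists_integrable_forall_norm_comp_sub_le {E : Type*} [NormedAddCommGroup E]
    [NormedSpace ℝ E] (g : 𝓢(V, E)) :
    ∃ m : V → ℝ, Integrable m ∧ ∀ y z, ‖z‖ ≤ 1 → ‖g (y - z)‖ ≤ m y := by
  obtain ⟨C, hC⟩ : ∃ C, ∀ x, (1 + ‖x‖) ^ (Module.finrank ℝ V + 1) * ‖g x‖ ≤ C := ⟨_, fun x => by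
    simpa only [norm_iteratedFDeriv_zero] using SchwartzMap.one_add_le_sup_seminorm_apply
      (𝕜 := ℝ) (m := (Module.finrank ℝ V + 1, 0)) le_rfl le_rfl g x⟩
  refine ⟨fun y => C * 2 ^ (Module.finrank ℝ V + 1) *
    (1 + ‖y‖) ^ (-((Module.finrank ℝ V + 1 : ℕ) : ℝ)),
    (integrable_one_add_norm (by push_cast; linarith)).const_mul _, fun y z hz => ?_⟩
  have hyz : 1 + ‖y‖ ≤ 2 * (1 + ‖y - z‖) := by
    linarith [norm_sub_norm_le y z, norm_nonneg (y - z)]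
  beta_reduce
  rw [Real.rpow_neg (by positivity), Real.rpow_natCast, ← div_eq_mul_inv,
    le_div_iff₀ (by positivity)]
  calc ‖g (y - z)‖ * (1 + ‖y‖) ^ (Module.finrank ℝ V + 1)
      ≤ ‖g (y - z)‖ * (2 * (1 + ‖y - z‖)) ^ (Module.finrank ℝ V + 1) := by gcongr
    _ = (1 + ‖y - z‖) ^ (Module.finrank ℝ V + 1) * ‖g (y - z)‖ *
          2 ^ (Module.finrank ℝ V + 1) := by
        rw [mul_pow]
        ring
    _ ≤ C * 2 ^ (Module.finrank ℝ V + 1) := by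
        gcongr
        exact hC _

theorem hasFDerivAt_integral_comp_sub_mul {h : V → ℂ} {C : ℝ} (hh : Continuous h)
    (hC : ∀ x, ‖h x‖ ≤ C) (z : V) :
    HasFDerivAt (fun z => ∫ y, k (y - z) * h y) (∫ y, h y • -fderiv ℝ k (y - z)) z := by
  obtain ⟨m, hm, hkm⟩ := exists_integrable_forall_norm_comp_sub_le (SchwartzMap.fderivCLM ℝ V ℂ k)
  have hk' : Continuous (fderiv ℝ k) := (SchwartzMap.fderivCLM ℝ V ℂ k).continuous
  refine hasFDerivAt_integral_of_dominated_of_fderiv_le (𝕜 := ℝ)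
    (F' := fun z y => h y • -fderiv ℝ k (y - z)) (s := Metric.closedBall z 1)
    (bound := fun y => C * m (y - z)) (Metric.closedBall_mem_nhds z one_pos)
    (Eventually.of_forall fun x => ?_) ?_ ?_ (ae_of_all _ fun y x hx => ?_)
    ((hm.comp_sub_right z).const_mul C) (ae_of_all _ fun y x _ => ?_)
  · exact (Continuous.mul (by fun_prop) hh).aestronglyMeasurable
  · exact (k.integrable.comp_sub_right z).mul_bdd hh.aestronglyMeasurable (ae_of_all _ hC)
  · exact (hh.smul (hk'.comp (by fun_prop)).neg).aestronglyMeasurable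
  · have hyx : y - x = y - z - (x - z) := by abel
    rw [norm_smul, norm_neg, hyx]
    exact mul_le_mul (hC y) (hkm _ _ (by rwa [← dist_eq_norm])) (norm_nonneg _)
      ((norm_nonneg _).trans (hC y))
  · convert! ((k.hasFDerivAt (y - x)).comp x ((hasFDerivAt_id (𝕜 := ℝ) x).const_sub y)).mul_const
      (h y) using 1
    ext v
    simp

theorem norm_integral_smul_neg_fderiv_comp_sub_le {h : V → ℂ} {C : ℝ} (hC : ∀ x, ‖h x‖ ≤ C)
    (z : V) : ‖∫ y, h y • -fderiv ℝ k (y - z)‖ ≤ C * ∫ y, ‖fderiv ℝ k y‖ := by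
  have hk' : Integrable fun y => ‖fderiv ℝ k y‖ := (SchwartzMap.fderivCLM ℝ V ℂ k).integrable.norm
  rw [← integral_sub_right_eq_self (fun y => ‖fderiv ℝ k y‖) z, ← integral_const_mul]
  refine norm_integral_le_of_norm_le ((hk'.comp_sub_right z).const_mul C) (ae_of_all _ fun y => ?_)
  rw [norm_smul, norm_neg]
  exact mul_le_mul_of_nonneg_right (hC y) (norm_nonneg _)

theorem packetIntegral_symm_eq (P : V ≃L[ℝ] V) (f : V → ℂ) :
    packetIntegral k P.symm κ f b =
      (𝐞 ⟪κ, b⟫ : ℂ) * ∫ y, k (y - P b) * ((𝐞 (-⟪κ, P.symm y⟫) : ℂ) * f (P.symm y)) := by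
  rw [← integral_add_right_eq_self _ (P b), ← integral_const_mul, packetIntegral]
  congr 1 with y
  have hphase : -⟪κ, P.symm y⟫ = ⟪κ, b⟫ + -⟪κ, P.symm (y + P b)⟫ := by
    rw [map_add, P.symm_apply_apply, inner_add_right]
    ring
  rw [ContinuousLinearEquiv.coe_coe, hphase, AddChar.map_add_eq_mul, Circle.coe_mul,
    add_sub_cancel_right, map_add, P.symm_apply_apply, add_comm b]
  ring

/-- Differentiating the carrier `𝐞 ⟪κ, b⟫` of the packet gives the main term; the other term has
no factor `κ`. -/
theorem exists_hasFDerivAt_packetIntegral (P : V ≃L[ℝ] V) {f : V → ℂ} {C : ℝ} (hf : Continuous f)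
    (hC : ∀ x, ‖f x‖ ≤ C) :
    ∃ L, HasFDerivAt (packetIntegral k P.symm κ f) L b ∧
      ‖L - (innerSL ℝ κ).smulRight (2 * Real.pi * Complex.I * packetIntegral k P.symm κ f b)‖ ≤
        C * (∫ y, ‖fderiv ℝ k y‖) * ‖(P : V →L[ℝ] V)‖ := by
  let h : V → ℂ := fun y => (𝐞 (-⟪κ, P.symm y⟫) : ℂ) * f (P.symm y)
  have hh : Continuous h :=
    (continuous_fourierChar_comp (by fun_prop)).mul (hf.comp P.symm.continuous)
  have hhC : ∀ y, ‖h y‖ ≤ C := fun y => by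
    rw [norm_mul, Circle.norm_coe, one_mul]
    exact hC _
  let D : V →L[ℝ] ℂ := ∫ y, h y • -fderiv ℝ k (y - P b)
  have hcarrier : HasFDerivAt (fun b => (𝐞 ⟪κ, b⟫ : ℂ)) _ b :=
    hasFDerivAt_fourierChar_comp (innerSL ℝ κ).hasFDerivAt
  have hprod := hcarrier.mul
    ((hasFDerivAt_integral_comp_sub_mul k hh hhC (P b)).comp b (P : V →L[ℝ] V).hasFDerivAt)
  refine ⟨(𝐞 ⟪κ, b⟫ : ℂ) • D ∘L P +
    (innerSL ℝ κ).smulRight (2 * Real.pi * Complex.I * packetIntegral k P.symm κ f b), ?_, ?_⟩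
  · rw [show packetIntegral k P.symm κ f = _ from funext fun b => packetIntegral_symm_eq k κ b P f]
    convert! hprod using 1
    ext v
    simp only [D, h, add_apply, smul_apply, ContinuousLinearMap.smulRight_apply,
      Function.comp_apply, smul_eq_mul, Complex.real_smul]
    ring
  · rw [add_sub_cancel_right, norm_smul, Circle.norm_coe, one_mul]
    exact (ContinuousLinearMap.opNorm_comp_le _ _).trans (mul_le_mul_of_nonneg_right
      (norm_integral_smul_neg_fderiv_comp_sub_le k hhC (P b)) (norm_nonneg _))

theorem integral_eq_abs_det_smul_integral_comp_add {E : Type*} [NormedAddCommGroup E]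
    [NormedSpace ℝ E] (B : V ≃L[ℝ] V) (b : V) (g : V → E) :
    ∫ x, g x = |LinearMap.det ((B : V →L[ℝ] V) : V →ₗ[ℝ] V)| • ∫ y, g (b + B y) := by
  have hdet : LinearMap.det ((B : V →L[ℝ] V) : V →ₗ[ℝ] V) ≠ 0 :=
    B.toLinearEquiv.isUnit_det'.ne_zero
  have hmap := Measure.map_linearMap_addHaar_eq_smul_addHaar (volume : Measure V) hdet
  have hint := B.toHomeomorph.measurableEmbedding.integral_map (μ := volume) fun x => g (b + x)
  change ∫ x, g (b + x) ∂(Measure.map B volume) = ∫ y, g (b + B y) at hint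
  change Measure.map B volume = _ at hmap
  rw [← hint, hmap, integral_smul_measure, ENNReal.toReal_ofReal (abs_nonneg _), smul_smul, abs_inv,
    mul_inv_cancel₀ (abs_ne_zero.2 hdet), one_smul, integral_add_left_eq_self g b]

end Packet

/-! ### Anisotropic dilations of the plane -/

open Matrix (toEuclideanCLM)

theorem scalingMatrix_eq_diagonal (s t a : ℝ) :
    scalingMatrix s t a = Matrix.diagonal ![a ^ t, a ^ s] := by
  ext i j
  fin_cases i <;> fin_cases j <;> simp [scalingMatrix]

theorem inv_scalingMatrix (s t : ℝ) {a : ℝ} (ha : 0 < a) :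
    (scalingMatrix s t a)⁻¹ = scalingMatrix (-s) (-t) a := by
  refine Matrix.inv_eq_left_inv ?_
  rw [scalingMatrix_eq_diagonal, scalingMatrix_eq_diagonal, Matrix.diagonal_mul_diagonal,
    ← Matrix.diagonal_one]
  congr 1 with i
  fin_cases i <;> simp [← Real.rpow_add ha]

theorem det_scalingMatrix (s t : ℝ) {a : ℝ} (ha : 0 < a) :
    (scalingMatrix s t a).det = a ^ (s + t) := by
  rw [scalingMatrix, Matrix.det_fin_two_of, Real.rpow_add ha]
  ring

theorem det_rotationMatrix (θ : ℝ) : (rotationMatrix θ).det = 1 := by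
  rw [rotationMatrix, Matrix.det_fin_two_of]
  linear_combination Real.sin_sq_add_cos_sq θ

theorem rotationMatrix_mem_unitary (θ : ℝ) :
    rotationMatrix θ ∈ unitary (Matrix (Fin 2) (Fin 2) ℝ) := by
  rw [← Matrix.unitaryGroup, Matrix.mem_unitaryGroup_iff]
  ext i j
  fin_cases i <;> fin_cases j <;>
    simp [rotationMatrix, Matrix.mul_apply, Matrix.star_apply] <;>
    grind [Real.sin_sq_add_cos_sq]

theorem inv_rotationMatrix (θ : ℝ) : (rotationMatrix θ)⁻¹ = star (rotationMatrix θ) :=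
  Matrix.inv_eq_left_inv (Unitary.star_mul_self_of_mem (rotationMatrix_mem_unitary θ))

theorem det_packetMatrix (s t : ℝ) {a : ℝ} (ha : 0 < a) (θ : ℝ) :
    (scalingMatrix s t a * (rotationMatrix θ)⁻¹).det = a ^ (s + t) := by
  rw [Matrix.det_mul, Matrix.det_nonsing_inv, det_rotationMatrix, Ring.inverse_one, mul_one,
    det_scalingMatrix s t ha]

theorem isUnit_det_packetMatrix (s t : ℝ) {a : ℝ} (ha : 0 < a) (θ : ℝ) :
    IsUnit (scalingMatrix s t a * (rotationMatrix θ)⁻¹).det := by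
  rw [det_packetMatrix s t ha]
  exact (Real.rpow_pos_of_pos ha _).ne'.isUnit

theorem star_inv_packetMatrix (s t a θ : ℝ) :
    star (scalingMatrix s t a * (rotationMatrix θ)⁻¹)⁻¹ =
      (scalingMatrix s t a)⁻¹ * (rotationMatrix θ)⁻¹ := by
  have hA : (scalingMatrix s t a)ᴴ = scalingMatrix s t a := by
    rw [scalingMatrix_eq_diagonal, Matrix.diagonal_conjTranspose, star_trivial]
  rw [Matrix.star_eq_conjTranspose, Matrix.conjTranspose_nonsing_inv, Matrix.conjTranspose_mul, hA,
    inv_rotationMatrix, ← Matrix.star_eq_conjTranspose, star_star, Matrix.mul_inv_rev,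
    inv_rotationMatrix]

/-- The linear automorphism `spaceMap` of the plane, that is, `A_a R_θ⁻¹`. -/
def packetEquiv (s t : ℝ) {a : ℝ} (ha : 0 < a) (θ : ℝ) : Plane ≃L[ℝ] Plane :=
  .equivOfInverse' (toEuclideanCLM (𝕜 := ℝ) (scalingMatrix s t a * (rotationMatrix θ)⁻¹))
    (toEuclideanCLM (𝕜 := ℝ) (scalingMatrix s t a * (rotationMatrix θ)⁻¹)⁻¹)
    ((map_mul _ _ _).symm.trans (by
      rw [Matrix.mul_nonsing_inv _ (isUnit_det_packetMatrix s t ha θ), map_one]; rfl))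
    ((map_mul _ _ _).symm.trans (by
      rw [Matrix.nonsing_inv_mul _ (isUnit_det_packetMatrix s t ha θ), map_one]; rfl))

theorem coe_packetEquiv (s t : ℝ) {a : ℝ} (ha : 0 < a) (θ : ℝ) :
    ((packetEquiv s t ha θ : Plane ≃L[ℝ] Plane) : Plane →L[ℝ] Plane) =
      toEuclideanCLM (𝕜 := ℝ) (scalingMatrix s t a * (rotationMatrix θ)⁻¹) :=
  rfl

theorem coe_packetEquiv_symm (s t : ℝ) {a : ℝ} (ha : 0 < a) (θ : ℝ) :
    ((packetEquiv s t ha θ).symm : Plane →L[ℝ] Plane) =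
      toEuclideanCLM (𝕜 := ℝ) (scalingMatrix s t a * (rotationMatrix θ)⁻¹)⁻¹ :=
  rfl

theorem packetEquiv_apply (s t : ℝ) {a : ℝ} (ha : 0 < a) (θ : ℝ) (x : Plane) :
    packetEquiv s t ha θ x = spaceMap s t a θ x :=
  rfl

open ContinuousLinearMap (adjoint)

theorem adjoint_packetEquiv_symm (s t : ℝ) {a : ℝ} (ha : 0 < a) (θ : ℝ) :
    adjoint ((packetEquiv s t ha θ).symm : Plane →L[ℝ] Plane) =
      toEuclideanCLM (𝕜 := ℝ) ((scalingMatrix s t a)⁻¹ * (rotationMatrix θ)⁻¹) := by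
  rw [coe_packetEquiv_symm, ← ContinuousLinearMap.star_eq_adjoint, ← map_star,
    star_inv_packetMatrix]

theorem adjoint_packetEquiv_symm_apply (s t : ℝ) {a : ℝ} (ha : 0 < a) (θ : ℝ) (v : Plane) :
    adjoint ((packetEquiv s t ha θ).symm : Plane →L[ℝ] Plane) v = freqMap s t a θ v := by
  rw [adjoint_packetEquiv_symm]
  rfl

theorem det_packetEquiv_symm (s t : ℝ) {a : ℝ} (ha : 0 < a) (θ : ℝ) :
    LinearMap.det (((packetEquiv s t ha θ).symm : Plane →L[ℝ] Plane) : Plane →ₗ[ℝ] Plane) =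
      a ^ (-(s + t)) := by
  rw [coe_packetEquiv_symm, Matrix.coe_toEuclideanCLM_eq_toEuclideanLin, LinearMap.det_toLpLin,
    Matrix.det_nonsing_inv, det_packetMatrix s t ha, Ring.inverse_eq_inv', Real.rpow_neg ha.le]

section Norm

open scoped Matrix.Norms.L2Operator

theorem norm_scalingMatrix_le {s t a c : ℝ} (ha : 0 ≤ a) (hs : a ^ s ≤ c) (ht : a ^ t ≤ c) :
    ‖scalingMatrix s t a‖ ≤ c := by
  rw [scalingMatrix_eq_diagonal, Matrix.l2_opNorm_diagonal,
    pi_norm_le_iff_of_nonneg ((Real.rpow_nonneg ha s).trans hs)]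
  intro i
  fin_cases i <;> simpa [abs_of_nonneg (Real.rpow_nonneg ha _)]

theorem norm_packetEquiv_le {s t a : ℝ} (hst : s ≤ t) (ha : 1 ≤ a) (θ : ℝ) :
    ‖(packetEquiv s t (one_pos.trans_le ha) θ : Plane →L[ℝ] Plane)‖ ≤ a ^ t := by
  rw [coe_packetEquiv, ← Matrix.cstar_norm_def, inv_rotationMatrix,
    CStarRing.norm_mul_mem_unitary _ (Unitary.star_mem (rotationMatrix_mem_unitary θ))]
  exact norm_scalingMatrix_le (by positivity) (Real.rpow_le_rpow_of_exponent_le ha hst) le_rfl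

theorem norm_packetEquiv_symm_le {s t a : ℝ} (hst : s ≤ t) (ha : 1 ≤ a) (θ : ℝ) :
    ‖((packetEquiv s t (one_pos.trans_le ha) θ).symm : Plane →L[ℝ] Plane)‖ ≤ a ^ (-s) := by
  rw [← LinearIsometryEquiv.norm_map adjoint, adjoint_packetEquiv_symm, ← Matrix.cstar_norm_def,
    inv_rotationMatrix,
    CStarRing.norm_mul_mem_unitary _ (Unitary.star_mem (rotationMatrix_mem_unitary θ)),
    inv_scalingMatrix s t (one_pos.trans_le ha)]
  exact norm_scalingMatrix_le (by positivity) le_rfl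
    (Real.rpow_le_rpow_of_exponent_le ha (neg_le_neg hst))

end Norm

theorem norm_le_rpow_mul_norm_freqMap {s t a : ℝ} (hst : s ≤ t) (ha : 1 ≤ a) (θ : ℝ) (v : Plane) :
    ‖v‖ ≤ a ^ t * ‖freqMap s t a θ v‖ := by
  let P := packetEquiv s t (one_pos.trans_le ha) θ
  have hv : adjoint (P : Plane →L[ℝ] Plane) (freqMap s t a θ v) = v := by
    rw [← adjoint_packetEquiv_symm_apply s t (one_pos.trans_le ha) θ v,
      ← ContinuousLinearMap.comp_apply, ← ContinuousLinearMap.adjoint_comp, P.coe_symm_comp_coe,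
      ContinuousLinearMap.adjoint_id, ContinuousLinearMap.id_apply]
  calc ‖v‖ = ‖adjoint (P : Plane →L[ℝ] Plane) (freqMap s t a θ v)‖ := by rw [hv]
    _ ≤ ‖adjoint (P : Plane →L[ℝ] Plane)‖ * ‖freqMap s t a θ v‖ :=
        ContinuousLinearMap.le_opNorm _ _
    _ ≤ a ^ t * ‖freqMap s t a θ v‖ := by
        rw [LinearIsometryEquiv.norm_map]
        gcongr
        exact norm_packetEquiv_le hst ha θ

theorem norm_unitVec (θ : ℝ) : ‖unitVec θ‖ = 1 := by
  rw [EuclideanSpace.norm_eq, Fin.sum_univ_two]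
  simp [unitVec]

theorem norm_smul_unitVec {a : ℝ} (ha : 0 ≤ a) (θ : ℝ) : ‖a • unitVec θ‖ = a := by
  rw [norm_smul, norm_unitVec, mul_one, Real.norm_of_nonneg ha]

/-! ### The wave packet transform -/

/-- The Schwartz function `x ↦ conj (k x)`. -/
def conjSchwartz {E : Type*} [NormedAddCommGroup E] [NormedSpace ℝ E] (k : 𝓢(E, ℂ)) : 𝓢(E, ℂ) :=
  k.postcompCLM (Complex.conjCLE : ℂ →L[ℝ] ℂ)

theorem conjSchwartz_apply {E : Type*} [NormedAddCommGroup E] [NormedSpace ℝ E] (k : 𝓢(E, ℂ))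
    (x : E) : conjSchwartz k x = conj (k x) :=
  rfl

theorem fourierInv_conjSchwartz {V : Type*} [NormedAddCommGroup V] [InnerProductSpace ℝ V]
    [FiniteDimensional ℝ V] [MeasurableSpace V] [BorelSpace V] (k : 𝓢(V, ℂ)) (v : V) :
    𝓕⁻ (conjSchwartz k) v = conj (𝓕 k v) := by
  rw [SchwartzMap.fourierInv_coe, SchwartzMap.fourier_coe, Real.fourierInv_eq, Real.fourier_eq,
    ← integral_conj]
  congr 1 with y
  rw [Circle.smul_def, Circle.smul_def, smul_eq_mul, smul_eq_mul, map_mul, ← Circle.coe_inv_eq_conj,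
    ← AddChar.map_neg_eq_inv, neg_neg, conjSchwartz_apply]

/-- The wave packet transform without the normalization `a^{-(s+t)/2}`. -/
abbrev packetCoeff (s t : ℝ) (w : 𝓢(Plane, ℂ)) {a : ℝ} (ha : 0 < a) (θ : ℝ) (f : Plane → ℂ)
    (b : Plane) : ℂ :=
  packetIntegral (conjSchwartz w) (packetEquiv s t ha θ).symm (a • unitVec θ) f b

theorem conj_wavePacket (s t : ℝ) (w : 𝓢(Plane, ℂ)) (a θ : ℝ) (b x : Plane) :
    conj (wavePacket s t w a θ b x) = ((a ^ ((t + s) / 2) : ℝ) : ℂ) *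
      (𝐞 (-⟪a • unitVec θ, x - b⟫) : ℂ) * conj (w (spaceMap s t a θ (x - b))) := by
  rw [wavePacket, map_mul, map_mul, Complex.conj_ofReal, ← Complex.exp_conj,
    Real.fourierChar_apply, real_inner_smul_left, real_inner_comm]
  congr 3
  simp only [map_mul, Complex.conj_I, Complex.conj_ofReal, map_ofNat]
  push_cast
  ring

theorem transform_eq_mul_packetCoeff (s t : ℝ) (w : 𝓢(Plane, ℂ)) (f : Plane → ℂ) {a : ℝ}
    (ha : 0 < a) (θ : ℝ) (b : Plane) :
    transform s t w f a θ b =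
      ((a ^ (-((s + t) / 2)) : ℝ) : ℂ) * packetCoeff s t w ha θ f b := by
  have hpow : a ^ (-((s + t) / 2)) = a ^ (-(s + t)) * a ^ ((t + s) / 2) := by
    rw [← Real.rpow_add ha]
    ring_nf
  rw [transform, integral_eq_abs_det_smul_integral_comp_add (packetEquiv s t ha θ).symm b,
    det_packetEquiv_symm, abs_of_pos (Real.rpow_pos_of_pos ha _), ← integral_smul, packetCoeff,
    packetIntegral, ← integral_const_mul, hpow]
  congr 1 with y
  rw [conj_wavePacket, add_sub_cancel_left, ← packetEquiv_apply s t ha,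
    ContinuousLinearEquiv.apply_symm_apply, Complex.real_smul, conjSchwartz_apply,
    ContinuousLinearEquiv.coe_coe]
  push_cast
  ring

theorem exists_hasFDerivAt_transform {s t : ℝ} (hst : s ≤ t) (w : 𝓢(Plane, ℂ)) {f : Plane → ℂ}
    {C : ℝ} (hf : Continuous f) (hC : ∀ x, ‖f x‖ ≤ C) {a : ℝ} (ha : 1 ≤ a) (θ : ℝ) (b : Plane) :
    ∃ L, HasFDerivAt (transform s t w f a θ) L b ∧
      ‖L - (innerSL ℝ (a • unitVec θ)).smulRight
          (2 * Real.pi * Complex.I * transform s t w f a θ b)‖ ≤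
        a ^ (-((s + t) / 2)) * (C * (∫ y, ‖fderiv ℝ (conjSchwartz w) y‖) * a ^ t) := by
  have ha0 : 0 < a := one_pos.trans_le ha
  have hC0 : 0 ≤ C := (norm_nonneg _).trans (hC 0)
  obtain ⟨L, hL, hLle⟩ := exists_hasFDerivAt_packetIntegral (conjSchwartz w) (a • unitVec θ) b
    (packetEquiv s t ha0 θ) hf hC
  let c : ℂ := ((a ^ (-((s + t) / 2)) : ℝ) : ℂ)
  have htransform : transform s t w f a θ = fun b => c * packetCoeff s t w ha0 θ f b :=
    funext fun b => transform_eq_mul_packetCoeff s t w f ha0 θ b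
  refine ⟨c • L, htransform ▸ hL.const_mul c, ?_⟩
  have hfactor : c • L - (innerSL ℝ (a • unitVec θ)).smulRight
        (2 * Real.pi * Complex.I * transform s t w f a θ b) =
      c • (L - (innerSL ℝ (a • unitVec θ)).smulRight
        (2 * Real.pi * Complex.I * packetCoeff s t w ha0 θ f b)) := by
    ext v
    simp only [htransform, sub_apply, smul_apply, ContinuousLinearMap.smulRight_apply, smul_eq_mul,
      Complex.real_smul]
    ring
  rw [hfactor, norm_smul, Complex.norm_of_nonneg (Real.rpow_nonneg ha0.le _)]
  gcongr
  refine hLle.trans ?_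
  gcongr
  exact norm_packetEquiv_le hst ha θ

theorem norm_le_norm_add_norm (v : EuclideanSpace ℂ (Fin 2)) : ‖v‖ ≤ ‖v 0‖ + ‖v 1‖ := by
  refine le_of_sq_le_sq ?_ (by positivity)
  rw [EuclideanSpace.norm_sq_eq, Fin.sum_univ_two]
  nlinarith [norm_nonneg (v 0), norm_nonneg (v 1)]

theorem toComplex_sub (v u : Plane) : toComplex (v - u) = toComplex v - toComplex u := by
  ext i
  simp [toComplex]

theorem norm_toComplex (v : Plane) : ‖toComplex v‖ = ‖v‖ := by
  simp [EuclideanSpace.norm_eq, toComplex]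

theorem norm_waveVectorEstimate_sub_le {s t : ℝ} {w : 𝓢(Plane, ℂ)} {f : Plane → ℂ} {a θ Q : ℝ}
    {b κ : Plane} {L : Plane →L[ℝ] ℂ} (hL : HasFDerivAt (transform s t w f a θ) L b)
    (hQ : ‖L - (innerSL ℝ κ).smulRight (2 * Real.pi * Complex.I * transform s t w f a θ b)‖ ≤ Q)
    (hW : transform s t w f a θ b ≠ 0) :
    ‖waveVectorEstimate s t w f a θ b - toComplex κ‖ ≤ Q / ‖transform s t w f a θ b‖ := by
  let W := transform s t w f a θ b
  have hcoord : ∀ i, ‖(waveVectorEstimate s t w f a θ b - toComplex κ) i‖ ≤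
      Q / (2 * Real.pi * ‖W‖) := fun i => by
    have hquot : (waveVectorEstimate s t w f a θ b - toComplex κ) i =
        (L - (innerSL ℝ κ).smulRight (2 * Real.pi * Complex.I * W)) (EuclideanSpace.single i 1) /
          (2 * Real.pi * Complex.I * W) := by
      simp only [PiLp.sub_apply, waveVectorEstimate, toComplex, hL.fderiv, sub_apply, sub_div,
        ContinuousLinearMap.smulRight_apply, innerSL_apply_apply, EuclideanSpace.inner_single_right,
        conj_trivial, one_mul, Complex.real_smul]
      rw [mul_div_cancel_right₀ _ (mul_ne_zero Complex.two_pi_I_ne_zero hW)]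
    rw [hquot, norm_div]
    refine div_le_div₀ ((norm_nonneg _).trans hQ) ((ContinuousLinearMap.le_opNorm _ _).trans ?_)
      (by positivity) ?_
    · rwa [PiLp.norm_single, norm_one, mul_one]
    · simp [abs_of_pos Real.pi_pos]
  have hQ0 : 0 ≤ Q := (norm_nonneg _).trans hQ
  calc _ ≤ Q / (2 * Real.pi * ‖W‖) + Q / (2 * Real.pi * ‖W‖) :=
        (norm_le_norm_add_norm _).trans (add_le_add (hcoord 0) (hcoord 1))
    _ = Q / (Real.pi * ‖W‖) := by ring
    _ ≤ Q / ‖W‖ := by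
        gcongr
        exact le_mul_of_one_le_left (norm_nonneg _) (by linarith [Real.pi_gt_three])

section Decay

variable {s t M Λ a : ℝ} {α Ψ : Plane → ℝ}

theorem IsIntrinsicMode.norm_packetCoeff_le_of_le_scale (h : IsIntrinsicMode M Λ α Ψ)
    (hs : 1 / 2 < s) (hs1 : s ≤ 1) (hst : s ≤ t) (hM : 0 < M) (hΛ : 0 < Λ) (w : 𝓢(Plane, ℂ))
    (ha : 1 ≤ a) (hΛa : Λ / (2 * M) ≤ a) (θ : ℝ) (b : Plane)
    (hzero : 𝓕 w (freqMap s t a θ (gradient Ψ b - a • unitVec θ)) = 0) :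
    ‖packetCoeff s t w (one_pos.trans_le ha) θ (intrinsicMode α Ψ) b‖ ≤
      (Λ / (2 * M)) ^ (-(2 * s - 1)) * (M * (∫ y, ‖y‖ ^ 1 * ‖conjSchwartz w y‖) +
        4 * Real.pi * M ^ 3 * ∫ y, ‖y‖ ^ 2 * ‖conjSchwartz w y‖) := by
  have ha0 : 0 < a := one_pos.trans_le ha
  let B : Plane →L[ℝ] Plane := (packetEquiv s t ha0 θ).symm
  have hB : ‖B‖ ≤ a ^ (-s) := norm_packetEquiv_symm_le hst ha θ
  have hpow : a ^ (-(2 * s - 1)) ≤ (Λ / (2 * M)) ^ (-(2 * s - 1)) :=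
    Real.rpow_le_rpow_of_nonpos (by positivity) hΛa (by linarith)
  have hB₁ : ‖B‖ ≤ (Λ / (2 * M)) ^ (-(2 * s - 1)) :=
    (hB.trans (Real.rpow_le_rpow_of_exponent_le ha (by linarith))).trans hpow
  have hB₂ : Λ * ‖B‖ ^ 2 ≤ 2 * M * (Λ / (2 * M)) ^ (-(2 * s - 1)) := by
    calc Λ * ‖B‖ ^ 2 ≤ 2 * M * a * (a ^ (-s)) ^ 2 := by
          gcongr
          rwa [div_le_iff₀' (by positivity)] at hΛa
      _ = 2 * M * a ^ (-(2 * s - 1)) := by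
          rw [mul_assoc, ← Real.rpow_natCast, ← Real.rpow_mul ha0.le, ← Real.rpow_one_add' ha0.le]
          · ring_nf
          · norm_num
            linarith
      _ ≤ _ := by gcongr
  have hnear := h.norm_packetIntegral_sub_le (conjSchwartz w) B (a • unitVec θ) b
  rw [adjoint_packetEquiv_symm_apply, fourierInv_conjSchwartz, hzero, map_zero, mul_zero,
    sub_zero] at hnear
  calc _ ≤ _ := hnear
    _ = M * ‖B‖ * (∫ y, ‖y‖ ^ 1 * ‖conjSchwartz w y‖) +
          2 * Real.pi * M ^ 2 * (Λ * ‖B‖ ^ 2) * ∫ y, ‖y‖ ^ 2 * ‖conjSchwartz w y‖ := by ring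
    _ ≤ M * (Λ / (2 * M)) ^ (-(2 * s - 1)) * (∫ y, ‖y‖ ^ 1 * ‖conjSchwartz w y‖) +
          2 * Real.pi * M ^ 2 * (2 * M * (Λ / (2 * M)) ^ (-(2 * s - 1))) *
            ∫ y, ‖y‖ ^ 2 * ‖conjSchwartz w y‖ := by gcongr
    _ = _ := by ring

theorem IsIntrinsicMode.le_norm_gradient_sub (h : IsIntrinsicMode M Λ α Ψ) (ha : 0 ≤ a)
    (haΛ : a ≤ Λ / (2 * M)) (θ : ℝ) (x : Plane) :
    Λ / (2 * M) ≤ ‖gradient Ψ x - a • unitVec θ‖ := by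
  have hhalf : Λ / M = 2 * (Λ / (2 * M)) := by ring
  linarith [norm_sub_norm_le (gradient Ψ x) (a • unitVec θ), h.le_norm_gradient x,
    norm_smul_unitVec ha θ]

theorem rpow_neg_sq_mul_rpow_le_one (ha : 1 ≤ a) (hts : t ≤ 2 * s) :
    (a ^ (-s)) ^ 2 * a ^ t ≤ 1 := by
  have ha0 : 0 < a := one_pos.trans_le ha
  rw [← Real.rpow_natCast, ← Real.rpow_mul ha0.le, ← Real.rpow_add ha0]
  push_cast
  exact Real.rpow_le_one_of_one_le_of_nonpos ha (by linarith)

theorem IsIntrinsicMode.norm_packetCoeff_le_of_scale_le (h : IsIntrinsicMode M Λ α Ψ)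
    (hs : 1 / 2 < s) (hst : s ≤ t) (ht : t < 1) (hM : 0 < M) (w : 𝓢(Plane, ℂ)) (ha : 1 ≤ a)
    (haΛ : a ≤ Λ / (2 * M)) (θ : ℝ) (b : Plane) :
    ‖packetCoeff s t w (one_pos.trans_le ha) θ (intrinsicMode α Ψ) b‖ ≤
      (Λ / (2 * M)) ^ (-(1 - t)) * (M * (∫ y, ‖fderiv ℝ (conjSchwartz w) y‖) +
        (M + 2 * M ^ 3) * ∫ y, ‖conjSchwartz w y‖) := by
  have ha0 : 0 < a := one_pos.trans_le ha
  let B : Plane →L[ℝ] Plane := (packetEquiv s t ha0 θ).symm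
  let x := Λ / (2 * M)
  have hx : 0 < x := ha0.trans_le haΛ
  have hΛ : Λ = 2 * M * x := by simp only [x]; field_simp
  have hB : ‖B‖ ≤ a ^ (-s) := norm_packetEquiv_symm_le hst ha θ
  have hB₁ : ‖B‖ ≤ 1 := hB.trans (Real.rpow_le_one_of_one_le_of_nonpos ha (by linarith))
  have hpow : a ^ t / x ≤ x ^ (-(1 - t)) := by
    rw [neg_sub, Real.rpow_sub_one hx.ne']
    gcongr
    linarith
  have hBa : ‖B‖ ^ 2 * a ^ t ≤ 1 := by
    refine le_trans ?_ (rpow_neg_sq_mul_rpow_le_one ha (by linarith : t ≤ 2 * s))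
    gcongr
  have hB₂ : Λ * M * ‖B‖ ^ 2 / (x / a ^ t) ^ 2 ≤ 2 * M ^ 2 * (a ^ t / x) := by
    calc _ = 2 * M ^ 2 * (a ^ t / x) * (‖B‖ ^ 2 * a ^ t) := by rw [hΛ]; field_simp
      _ ≤ _ := mul_le_of_le_one_right (by positivity) hBa
  have hK : ∀ y, x / a ^ t ≤ ‖adjoint B (gradient Ψ y - a • unitVec θ)‖ := fun y => by
    rw [adjoint_packetEquiv_symm_apply, div_le_iff₀' (by positivity)]
    exact (h.le_norm_gradient_sub ha0.le haΛ θ y).trans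
      (norm_le_rpow_mul_norm_freqMap hst ha θ _)
  have hfar := h.norm_packetIntegral_le (conjSchwartz w) B (a • unitVec θ) b (by positivity) hK
  rw [inv_div, finrank_euclideanSpace_fin, Nat.cast_ofNat, mul_assoc] at hfar
  have hfar' := le_of_mul_le_mul_left hfar two_pos
  refine (le_mul_of_one_le_left (norm_nonneg _) (by linarith [Real.pi_gt_three])).trans
    (hfar'.trans ?_)
  calc _ ≤ a ^ t / x * (M * (∫ y, ‖fderiv ℝ (conjSchwartz w) y‖) +
          M * 1 * ∫ y, ‖conjSchwartz w y‖) +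
          2 * M ^ 2 * (a ^ t / x) * (M * ∫ y, ‖conjSchwartz w y‖) := by gcongr
    _ = a ^ t / x * (M * (∫ y, ‖fderiv ℝ (conjSchwartz w) y‖) +
          (M + 2 * M ^ 3) * ∫ y, ‖conjSchwartz w y‖) := by ring
    _ ≤ _ := by gcongr

theorem eventually_norm_packetCoeff_intrinsicMode_le {δ : ℝ} (hs : 1 / 2 < s) (hst : s ≤ t)
    (ht : t < 1) (hM : 0 < M) (w : 𝓢(Plane, ℂ)) (hδ : 0 < δ) :
    ∀ᶠ Λ in atTop, ∀ α Ψ : Plane → ℝ, IsIntrinsicMode M Λ α Ψ →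
      ∀ (a : ℝ) (ha : 1 ≤ a) (θ : ℝ) (b : Plane),
        𝓕 w (freqMap s t a θ (gradient Ψ b - a • unitVec θ)) = 0 →
          ‖packetCoeff s t w (one_pos.trans_le ha) θ (intrinsicMode α Ψ) b‖ ≤ δ := by
  have hsmall {p : ℝ} (hp : 0 < p) (c : ℝ) :
      ∀ᶠ Λ : ℝ in atTop, (Λ / (2 * M)) ^ (-p) * c ≤ δ := by
    have hlim := ((tendsto_rpow_neg_atTop hp).comp
      (tendsto_id.atTop_div_const (by positivity : 0 < 2 * M))).mul_const c
    rw [zero_mul] at hlim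
    exact hlim.eventually_le_const hδ
  filter_upwards [hsmall (p := 2 * s - 1) (by linarith) _, hsmall (p := 1 - t) (by linarith) _,
    eventually_gt_atTop 0] with Λ hnear hfar hΛ α Ψ h a ha θ b hzero
  rcases le_total (Λ / (2 * M)) a with hΛa | haΛ
  · exact (h.norm_packetCoeff_le_of_le_scale hs (hst.trans ht.le) hst hM hΛ w ha hΛa θ b
      hzero).trans hnear
  · exact (h.norm_packetCoeff_le_of_scale_le hs hst ht hM w ha haΛ θ b).trans hfar

end Decay

/-! ### Components of a general intrinsic mode type function -/

section Gradient

variable {V : Type*} [NormedAddCommGroup V] [InnerProductSpace ℝ V] [CompleteSpace V]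

theorem gradient_const_mul {f : V → ℝ} (hf : Differentiable ℝ f) (c : ℝ) :
    gradient (fun x => c * f x) = fun x => c • gradient f x := by
  refine gradient_eq fun x => ?_
  rw [hasGradientAt_iff_hasFDerivAt, map_smulₛₗ]
  exact (hf x).hasGradientAt.hasFDerivAt.const_mul c

theorem differentiable_gradient {f : V → ℝ} (hf : ContDiff ℝ 2 f) :
    Differentiable ℝ (gradient f) := by
  have htoDual : IsBoundedLinearMap ℝ (InnerProductSpace.toDual ℝ V).symm :=
    { map_add := map_add _, map_smul := by simp, bound := ⟨1, one_pos, by simp⟩ }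
  exact htoDual.differentiable.comp ((hf.fderiv_right (m := 1) le_rfl).differentiable one_ne_zero)

theorem isIntrinsicMode_const_mul {M Λ : ℝ} {α ψ : V → ℝ} (hΛ : 0 ≤ Λ) (hα : Differentiable ℝ α)
    (hα_le : ∀ x, |α x| ≤ M) (hα'_le : ∀ x, ‖gradient α x‖ ≤ M) (hψ : ContDiff ℝ 2 ψ)
    (hle : ∀ x, 1 / M ≤ ‖gradient ψ x‖) (hψ'' : ∀ x, ‖fderiv ℝ (gradient ψ) x‖ ≤ M) :
    IsIntrinsicMode M Λ α (fun x => Λ * ψ x) where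
  amp_differentiable := hα
  abs_amp_le := hα_le
  norm_fderiv_amp_le x := by
    rw [← toDual_gradient, LinearIsometryEquiv.norm_map]
    exact hα'_le x
  phase_differentiable := (hψ.differentiable two_ne_zero).const_mul Λ
  gradient_differentiable := differentiable_gradient (contDiff_const.mul hψ)
  norm_fderiv_gradient_le x := by
    rw [gradient_const_mul (hψ.differentiable two_ne_zero),
      fderiv_fun_const_smul (differentiable_gradient hψ x), norm_smul, Real.norm_of_nonneg hΛ]
    exact mul_le_mul_of_nonneg_left (hψ'' x) hΛ
  le_norm_gradient x := by
    rw [gradient_const_mul (hψ.differentiable two_ne_zero), norm_smul, Real.norm_of_nonneg hΛ,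
      div_eq_mul_one_div]
    exact mul_le_mul_of_nonneg_left (hle x) hΛ

end Gradient

section Phase

variable (F : Matrix (Fin 2) (Fin 2) ℝ) {φ : Plane → Plane}

theorem rowVec_sub (n m : Fin 2 → ℤ) : rowVec F (n - m) = rowVec F n - rowVec F m := by
  rw [rowVec, rowVec, rowVec, ← WithLp.toLp_sub, ← Matrix.sub_vecMul]
  congr 2 with i
  push_cast [Pi.sub_apply]
  rfl

theorem phase_sub (φ : Plane → Plane) (n m : Fin 2 → ℤ) (x : Plane) :
    phase F φ (n - m) x = phase F φ n x - phase F φ m x := by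
  rw [phase, rowVec_sub, inner_sub_left, phase, phase]

theorem phase_eq_norm_mul_normPhase (φ : Plane → Plane) (n : Fin 2 → ℤ) :
    phase F φ n = fun x => ‖rowVec F n‖ * normPhase F φ n x := by
  ext x
  rw [normPhase, mul_div_cancel_of_imp']
  intro hn
  rw [phase, norm_eq_zero.1 hn, inner_zero_left]

theorem contDiff_normPhase {k : WithTop ℕ∞} (hφ : ContDiff ℝ k φ) (n : Fin 2 → ℤ) :
    ContDiff ℝ k (normPhase F φ n) :=
  (contDiff_const.inner ℝ hφ).div_const _

theorem differentiable_phase (hφ : Differentiable ℝ φ) (n : Fin 2 → ℤ) :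
    Differentiable ℝ (phase F φ n) :=
  (differentiable_const _).inner ℝ hφ

theorem localWaveVector_eq_gradient (N : ℝ) (hφ : Differentiable ℝ φ) (n : Fin 2 → ℤ) :
    localWaveVector N F φ n = gradient fun x => N * phase F φ n x :=
  (gradient_const_mul (differentiable_phase F hφ n) N).symm

theorem localWaveVector_eq_smul_gradient_normPhase (N : ℝ) (hφ : Differentiable ℝ φ)
    (n : Fin 2 → ℤ) (x : Plane) :
    localWaveVector N F φ n x = (N * ‖rowVec F n‖) • gradient (normPhase F φ n) x := by
  have hnorm : Differentiable ℝ (normPhase F φ n) := by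
    have hphase := differentiable_phase F hφ n
    unfold normPhase
    fun_prop
  rw [localWaveVector, phase_eq_norm_mul_normPhase, gradient_const_mul hnorm, smul_smul]

theorem localWaveVector_sub (N : ℝ) (hφ : Differentiable ℝ φ) (n m : Fin 2 → ℤ) (x : Plane) :
    localWaveVector N F φ (n - m) x = localWaveVector N F φ n x - localWaveVector N F φ m x := by
  rw [localWaveVector, localWaveVector, localWaveVector, ← smul_sub]
  congr 1
  refine HasGradientAt.gradient ?_
  rw [hasGradientAt_iff_hasFDerivAt, map_sub]
  refine HasFDerivAt.congr_of_eventuallyEq ?_ (.of_forall (phase_sub F φ n m))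
  exact (differentiable_phase F hφ n x).hasGradientAt.hasFDerivAt.sub
    (differentiable_phase F hφ m x).hasGradientAt.hasFDerivAt

theorem intDot_smul_toEuclideanLin (c : ℝ) (n : Fin 2 → ℤ) (v : Plane) :
    intDot n (c • Matrix.toEuclideanLin F v) = c * ⟪rowVec F n, v⟫ := by
  simp [intDot, rowVec, Matrix.toLpLin_apply, Matrix.vecMul, dotProduct, Fin.sum_univ_two,
    PiLp.inner_apply]
  ring

end Phase

theorem IsShapeFunction.ne_zero_of_mem_spectrum2 {M : ℝ} {S : Plane → ℂ} (h : IsShapeFunction M S)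
    {n : Fin 2 → ℤ} (hn : n ∈ spectrum2 S) : n ≠ 0 := by
  rintro rfl
  exact hn h.mean_zero

theorem IsShapeFunction.continuous {M : ℝ} {S : Plane → ℂ} (h : IsShapeFunction M S) :
    Continuous S := by
  refine h.series.continuous (Frequently.of_forall fun A => ?_)
  unfold intDot
  fun_prop

namespace IsGIMT

variable {M N : ℝ} {F : Matrix (Fin 2) (Fin 2) ℝ} {α : Plane → ℝ} {S : Plane → ℂ}
  {φ : Plane → Plane} {f : Plane → ℂ} {n m : Fin 2 → ℤ}

theorem nonneg (h : IsGIMT M N F α S φ f) : 0 ≤ M :=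
  (norm_nonneg _).trans (h.shape.norm_sup 0)

theorem abs_amp_le (h : IsGIMT M N F α S φ f) (x : Plane) : |α x| ≤ M := by
  rw [abs_of_nonneg ((one_div_nonneg.2 h.nonneg).trans (h.amp_lower x))]
  exact h.amp_upper x

theorem phase_differentiable (h : IsGIMT M N F α S φ f) : Differentiable ℝ φ :=
  h.phase_smooth.differentiable (by simp)

theorem isIntrinsicMode (h : IsGIMT M N F α S φ f) (hN : 0 ≤ N) (hn : n ∈ spectrum2 S) :
    IsIntrinsicMode M (N * ‖rowVec F n‖) α (fun x => N * phase F φ n x) := by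
  simp only [phase_eq_norm_mul_normPhase F φ n, ← mul_assoc]
  exact isIntrinsicMode_const_mul (by positivity) (h.amp_smooth.differentiable (by simp))
    h.abs_amp_le h.amp_grad (contDiff_normPhase F (h.phase_smooth.of_le (by norm_cast)) n)
    (h.grad_lower n hn) (h.hess_upper n hn)

theorem le_norm_localWaveVector (h : IsGIMT M N F α S φ f) (hN : 0 ≤ N) (hn : n ∈ spectrum2 S)
    (hF : 1 ≤ ‖rowVec F n‖) (x : Plane) : N / M ≤ ‖localWaveVector N F φ n x‖ := by
  rw [localWaveVector_eq_gradient F N h.phase_differentiable]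
  refine le_trans ?_ ((h.isIntrinsicMode hN hn).le_norm_gradient x)
  exact div_le_div_of_nonneg_right (le_mul_of_one_le_right hN hF) h.nonneg

theorem le_norm_localWaveVector_sub (h : IsGIMT M N F α S φ f) (hN : 0 ≤ N)
    (hn : n ∈ spectrum2 S) (hm : m ∈ spectrum2 S) (hnm : n ≠ m) (hF : 1 ≤ ‖rowVec F (n - m)‖)
    (x : Plane) : N / M ≤ ‖localWaveVector N F φ n x - localWaveVector N F φ m x‖ := by
  rw [← localWaveVector_sub F N h.phase_differentiable,
    localWaveVector_eq_smul_gradient_normPhase F N h.phase_differentiable, norm_smul,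
    Real.norm_of_nonneg (by positivity), div_eq_mul_one_div]
  exact mul_le_mul (le_mul_of_one_le_right hN hF) (h.grad_sep n hn m hm hnm x)
    (one_div_nonneg.2 h.nonneg) (by positivity)

theorem hasSum_intrinsicMode (h : IsGIMT M N F α S φ f) (x : Plane) :
    HasSum (fun n => fourierCoeff2 S n * intrinsicMode α (fun x => N * phase F φ n x) x) (f x) := by
  have hseries : HasSum (fun n => fourierCoeff2 S n * Complex.exp
      (Complex.I * (intDot n ((2 * Real.pi * N) • Matrix.toEuclideanLin F (φ x)) : ℂ))) _ :=
    h.shape.series.tendsto_at _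
  rw [h.eq x]
  refine (hseries.mul_left (α x : ℂ)).congr_fun fun n => ?_
  rw [intrinsicMode, Real.fourierChar_apply, intDot_smul_toEuclideanLin, phase, mul_left_comm]
  congr 3
  push_cast
  ring

theorem norm_le (h : IsGIMT M N F α S φ f) (x : Plane) : ‖f x‖ ≤ M * M := by
  rw [h.eq x, norm_mul, Complex.norm_real]
  exact mul_le_mul (h.abs_amp_le x) (h.shape.norm_sup _) (norm_nonneg _) h.nonneg

theorem continuous (h : IsGIMT M N F α S φ f) : Continuous f := by
  have hS := h.shape.continuous
  have hα := h.amp_smooth.continuous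
  have hφ := h.phase_smooth.continuous
  have hF := (Matrix.toEuclideanLin F).continuous_of_finiteDimensional
  rw [funext h.eq]
  exact (Complex.continuous_ofReal.comp hα).mul
    (hS.comp ((hF.comp hφ).const_smul (2 * Real.pi * N)))

theorem norm_packetIntegral_le (h : IsGIMT M N F α S φ f) (k : 𝓢(Plane, ℂ))
    (B : Plane →L[ℝ] Plane) (κ b : Plane) {δ : ℝ} (hδ : 0 ≤ δ)
    (hmode : ∀ n ∈ spectrum2 S,
      ‖packetIntegral k B κ (intrinsicMode α fun x => N * phase F φ n x) b‖ ≤ δ) :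
    ‖packetIntegral k B κ f b‖ ≤ M * δ := by
  have hcont : ∀ n, Continuous fun x =>
      fourierCoeff2 S n * intrinsicMode α (fun x => N * phase F φ n x) x := fun n =>
    continuous_const.mul (continuous_intrinsicMode h.amp_smooth.continuous
      ((differentiable_phase F h.phase_differentiable n).continuous.const_mul N))
  have hbound : ∀ n x, ‖fourierCoeff2 S n * intrinsicMode α (fun x => N * phase F φ n x) x‖ ≤
      ‖fourierCoeff2 S n‖ * M := fun n x => by
    rw [norm_mul, norm_intrinsicMode]
    exact mul_le_mul_of_nonneg_left (h.abs_amp_le x) (norm_nonneg _)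
  have hsum := hasSum_packetIntegral k B κ b hcont (h.shape.summable.mul_right M) hbound
    h.hasSum_intrinsicMode
  refine (hsum.norm_le_of_bounded (h.shape.summable.hasSum.mul_right δ) fun n => ?_).trans
    (mul_le_mul_of_nonneg_right h.shape.tsum_le hδ)
  rw [packetIntegral_const_mul, norm_mul]
  by_cases hn : fourierCoeff2 S n = 0
  · simp [hn]
  · exact mul_le_mul_of_nonneg_left (hmode n hn) (norm_nonneg _)

end IsGIMT

section LargeN

variable {s t d M N r ε : ℝ} {w : 𝓢(Plane, ℂ)} {F : Matrix (Fin 2) (Fin 2) ℝ} {φ : Plane → Plane}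
  {f : Plane → ℂ} {n : Fin 2 → ℤ} {a θ : ℝ} {b : Plane}

theorem norm_smul_unitVec_sub_le_of_mem_setZ (hst : s ≤ t)
    (hZ : (a, θ, b) ∈ setZ s t d M N r F φ n) :
    ‖a • unitVec θ - localWaveVector N F φ n b‖ ≤ a ^ t * d :=
  (norm_le_rpow_mul_norm_freqMap hst hZ.1.1 θ _).trans
    (mul_le_mul_of_nonneg_left hZ.2 (Real.rpow_nonneg (zero_le_one.trans hZ.1.1) t))

theorem sqrt_le_norm_packetCoeff_of_mem_setR (hR : (a, θ, b) ∈ setR s t w M N r ε f)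
    (ha : 0 < a) : √ε ≤ ‖packetCoeff s t w ha θ f b‖ := by
  have hle := hR.2
  simp only [transform_eq_mul_packetCoeff s t w f ha, norm_mul,
    Complex.norm_of_nonneg (Real.rpow_nonneg ha.le _)] at hle
  exact le_of_mul_le_mul_left hle (Real.rpow_pos_of_pos ha _)

theorem norm_waveVectorEstimate_sub_le_of_mem_setR (hst : s ≤ t) (hε : 0 < ε) {C : ℝ}
    (hf : Continuous f) (hC : ∀ x, ‖f x‖ ≤ C) (hR : (a, θ, b) ∈ setR s t w M N r ε f) :
    ‖waveVectorEstimate s t w f a θ b - toComplex (a • unitVec θ)‖ ≤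
      a ^ t * (C * (∫ y, ‖fderiv ℝ (conjSchwartz w) y‖) / √ε) := by
  have ha : 1 ≤ a := hR.1.1
  have hpow : 0 < a ^ (-((s + t) / 2)) := by positivity
  have hsqrt : 0 < √ε := Real.sqrt_pos.2 hε
  obtain ⟨L, hL, hLle⟩ := exists_hasFDerivAt_transform hst w hf hC ha θ b
  refine (norm_waveVectorEstimate_sub_le hL hLle
    (norm_pos_iff.1 ((mul_pos hpow hsqrt).trans_le hR.2))).trans ?_
  refine (div_le_div_of_nonneg_left ((norm_nonneg _).trans hLle) (mul_pos hpow hsqrt)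
    hR.2).trans_eq ?_
  rw [mul_div_mul_left _ _ hpow.ne']
  ring

theorem eventually_mul_rpow_le_mul {η : ℝ} (ht : t < 1) (c : ℝ) (hη : 0 < η) :
    ∀ᶠ x : ℝ in atTop, c * x ^ t ≤ η * x := by
  have hlim := (tendsto_rpow_neg_atTop (sub_pos.2 ht)).const_mul c
  rw [mul_zero] at hlim
  filter_upwards [hlim.eventually_le_const hη, eventually_gt_atTop 0] with x hx hx0
  calc c * x ^ t = c * x ^ (-(1 - t)) * x := by
        rw [mul_assoc, ← Real.rpow_add_one hx0.ne']
        ring_nf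
    _ ≤ η * x := by gcongr

theorem eventually_setR_subset_iUnion_setZ (hs : 1 / 2 < s) (hst : s ≤ t) (ht : t < 1)
    (hM : 0 < M) (hw : ∀ ξ : Plane, d < ‖ξ‖ → 𝓕 w ξ = 0) (r : ℝ) (hε : 0 < ε) :
    ∀ᶠ N in atTop, ∀ F : Matrix (Fin 2) (Fin 2) ℝ,
      (∀ n : Fin 2 → ℤ, n ≠ 0 → 1 ≤ ‖rowVec F n‖) → ∀ α S φ f, IsGIMT M N F α S φ f →
        setR s t w M N r ε f ⊆ ⋃ n ∈ spectrum2 S, setZ s t d M N r F φ n := by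
  have hsqrt : 0 < √ε := Real.sqrt_pos.2 hε
  have hδ : 0 < √ε / (2 * M) := by positivity
  filter_upwards [eventually_forall_ge_atTop.2
      (eventually_norm_packetCoeff_intrinsicMode_le hs hst ht hM w hδ), eventually_ge_atTop 0]
    with N hsmall hN F hF α S φ f h
  rintro ⟨a, θ, b⟩ hR
  have ha : 1 ≤ a := hR.1.1
  by_contra hZ
  simp only [mem_iUnion, not_exists] at hZ
  have hmode : ∀ n ∈ spectrum2 S, ‖packetCoeff s t w (one_pos.trans_le ha) θ
      (intrinsicMode α fun x => N * phase F φ n x) b‖ ≤ √ε / (2 * M) := fun n hn => by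
    refine hsmall (N * ‖rowVec F n‖)
      (le_mul_of_one_le_right hN (hF n (h.shape.ne_zero_of_mem_spectrum2 hn))) _ _
      (h.isIntrinsicMode hN hn) a ha θ b (hw _ (not_le.1 fun hle => hZ n hn ⟨hR.1, ?_⟩))
    rw [← localWaveVector_eq_gradient F N h.phase_differentiable] at hle
    rwa [freqMap, ← neg_sub, map_neg, norm_neg]
  have hlarge := sqrt_le_norm_packetCoeff_of_mem_setR hR (one_pos.trans_le ha)
  have hhalf : M * (√ε / (2 * M)) = √ε / 2 := by field_simp
  linarith [h.norm_packetIntegral_le _ _ _ b hδ.le hmode]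

theorem eventually_pairwiseDisjoint_setZ (hst : s ≤ t) (ht0 : 0 ≤ t) (ht : t < 1) (d : ℝ)
    (hM : 0 < M) (hr : 0 < r) :
    ∀ᶠ N in atTop, ∀ F : Matrix (Fin 2) (Fin 2) ℝ,
      (∀ n : Fin 2 → ℤ, n ≠ 0 → 1 ≤ ‖rowVec F n‖) → ∀ α S φ f, IsGIMT M N F α S φ f →
        (spectrum2 S).PairwiseDisjoint (setZ s t d M N r F φ) := by
  have hscale : Tendsto (fun N : ℝ => 2 * M * N * r) atTop atTop :=
    (tendsto_id.const_mul_atTop (by positivity)).atTop_mul_const hr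
  have hη : 0 < 1 / (4 * M ^ 2 * r) := by positivity
  filter_upwards [hscale.eventually (eventually_mul_rpow_le_mul ht (2 * d) hη),
    eventually_gt_atTop 0] with N hsmall hN F hF α S φ f h n hn m hm hnm
  rw [Function.onFun, disjoint_left]
  rintro ⟨a, θ, b⟩ hZn hZm
  have ha : 1 ≤ a := hZn.1.1
  have hd : 0 ≤ d := (norm_nonneg _).trans hZn.2
  have hsep := h.le_norm_localWaveVector_sub hN.le hn hm hnm (hF _ (sub_ne_zero.2 hnm)) b
  have hclose : ‖localWaveVector N F φ n b - localWaveVector N F φ m b‖ ≤ N / (2 * M) := by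
    calc _ = ‖(a • unitVec θ - localWaveVector N F φ m b) -
            (a • unitVec θ - localWaveVector N F φ n b)‖ := by rw [sub_sub_sub_cancel_left]
      _ ≤ a ^ t * d + a ^ t * d := (norm_sub_le _ _).trans
          (add_le_add (norm_smul_unitVec_sub_le_of_mem_setZ hst hZm)
            (norm_smul_unitVec_sub_le_of_mem_setZ hst hZn))
      _ = 2 * d * a ^ t := by ring
      _ ≤ 2 * d * (2 * M * N * r) ^ t := by
          gcongr
          exact hZn.1.2.1
      _ ≤ _ := hsmall
      _ = N / (2 * M) := by
          field_simp
          norm_num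
  have hhalf : N / M = 2 * (N / (2 * M)) := by field_simp
  have hpos : 0 < N / (2 * M) := by positivity
  linarith

theorem norm_localWaveVector_le_of_mem_setZ (hst : s ≤ t) (ht : t ≤ 1)
    (hZ : (a, θ, b) ∈ setZ s t d M N r F φ n) : ‖localWaveVector N F φ n b‖ ≤ a * (1 + |d|) := by
  have ha : 1 ≤ a := hZ.1.1
  have hpow : a ^ t ≤ a := (Real.rpow_le_rpow_of_exponent_le ha ht).trans_eq (Real.rpow_one a)
  calc ‖localWaveVector N F φ n b‖
      ≤ ‖a • unitVec θ‖ + ‖a • unitVec θ - localWaveVector N F φ n b‖ := norm_le_insert _ _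
    _ ≤ a + a ^ t * d := add_le_add (norm_smul_unitVec (zero_le_one.trans ha) θ).le
        (norm_smul_unitVec_sub_le_of_mem_setZ hst hZ)
    _ ≤ a + a ^ t * |d| := by
        gcongr
        exact le_abs_self d
    _ ≤ a + a * |d| := by gcongr
    _ = a * (1 + |d|) := by ring

theorem eventually_waveVectorEstimate_sub_le {η : ℝ} (hst : s ≤ t) (ht : t < 1) (d : ℝ)
    (hM : 0 < M) (w : 𝓢(Plane, ℂ)) (r : ℝ) (hε : 0 < ε) (hη : 0 < η) :
    ∀ᶠ N in atTop, ∀ F : Matrix (Fin 2) (Fin 2) ℝ,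
      (∀ n : Fin 2 → ℤ, n ≠ 0 → 1 ≤ ‖rowVec F n‖) → ∀ α S φ f, IsGIMT M N F α S φ f →
        ∀ n ∈ spectrum2 S, ∀ (a θ : ℝ) (b : Plane),
          (a, θ, b) ∈ setR s t w M N r ε f ∩ setZ s t d M N r F φ n →
          ‖waveVectorEstimate s t w f a θ b - toComplex (localWaveVector N F φ n b)‖ /
            ‖localWaveVector N F φ n b‖ ≤ η := by
  let Q := M * M * (∫ y, ‖fderiv ℝ (conjSchwartz w) y‖) / √ε
  have hscale : Tendsto (fun N : ℝ => N / M / (1 + |d|)) atTop atTop :=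
    (tendsto_id.atTop_div_const hM).atTop_div_const (by positivity)
  filter_upwards [hscale.eventually (eventually_forall_ge_atTop.2
      (eventually_mul_rpow_le_mul ht (Q + d + η * d) hη)), eventually_ge_atTop 0]
    with N hsmall hN F hF α S φ f h n hn a θ b ⟨hR, hZ⟩
  have ha : 1 ≤ a := hR.1.1
  have hκa := norm_smul_unitVec_sub_le_of_mem_setZ hst hZ
  have hκ_ge : a - a ^ t * d ≤ ‖localWaveVector N F φ n b‖ := by
    linarith [norm_sub_norm_le (a • unitVec θ) (localWaveVector N F φ n b),
      norm_smul_unitVec (zero_le_one.trans ha) θ]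
  have hNa : N / M / (1 + |d|) ≤ a := by
    rw [div_le_iff₀ (by positivity)]
    exact (h.le_norm_localWaveVector hN hn (hF n (h.shape.ne_zero_of_mem_spectrum2 hn)) b).trans
      (norm_localWaveVector_le_of_mem_setZ hst ht.le hZ)
  refine div_le_of_le_mul₀ (norm_nonneg _) hη.le ?_
  calc ‖waveVectorEstimate s t w f a θ b - toComplex (localWaveVector N F φ n b)‖
      ≤ a ^ t * Q + a ^ t * d := by
        rw [← sub_add_sub_cancel _ (toComplex (a • unitVec θ)), ← toComplex_sub]
        refine (norm_add_le _ _).trans (add_le_add ?_ ((norm_toComplex _).trans_le hκa))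
        exact norm_waveVectorEstimate_sub_le_of_mem_setR hst hε h.continuous h.norm_le hR
    _ = (Q + d + η * d) * a ^ t - η * (a ^ t * d) := by ring
    _ ≤ η * a - η * (a ^ t * d) := sub_le_sub_right (hsmall a hNa) _
    _ = η * (a - a ^ t * d) := by ring
    _ ≤ η * ‖localWaveVector N F φ n b‖ := by gcongr

end LargeN

theorem IsMotherWavePacket.fourier_eq_zero {s t d : ℝ} {w : 𝓢(Plane, ℂ)}
    (hw : IsMotherWavePacket s t d w) {ξ : Plane} (hξ : d < ‖ξ‖) : 𝓕 w ξ = 0 := by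
  by_contra hne
  have hmem : ξ ∈ tsupport fun ξ : Plane => 𝓕 w ξ := subset_tsupport _ hne
  rw [hw.support_eq, mem_closedBall_zero_iff] at hmem
  exact hξ.not_ge hmem

end CrystalSST

end

theorem mainTheorem1_general (s t d M : ℝ) (hs : 1 / 2 < s) (hst : s ≤ t) (ht : t < 1)
    (hM : 0 < M) (w : SchwartzMap CrystalSST.Plane ℂ)
    (hw : ∀ ξ : CrystalSST.Plane, d < ‖ξ‖ → 𝓕 w ξ = 0) :
    ∀ r : ℝ, 0 < r → ∀ ε : ℝ, 0 < ε → ∀ η : ℝ, 0 < η → ∃ N₀ : ℝ, 0 < N₀ ∧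
      ∀ N : ℝ, N₀ < N → ∀ F : Matrix (Fin 2) (Fin 2) ℝ,
        (∀ n : Fin 2 → ℤ, n ≠ 0 → 1 ≤ ‖CrystalSST.rowVec F n‖) →
        ∀ (α : CrystalSST.Plane → ℝ) (S : CrystalSST.Plane → ℂ)
          (φ : CrystalSST.Plane → CrystalSST.Plane) (f : CrystalSST.Plane → ℂ),
          CrystalSST.IsGIMT M N F α S φ f →
          ((CrystalSST.spectrum2 S).PairwiseDisjoint (CrystalSST.setZ s t d M N r F φ) ∧
            CrystalSST.setR s t w M N r ε f ⊆
              ⋃ n ∈ CrystalSST.spectrum2 S, CrystalSST.setZ s t d M N r F φ n) ∧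
          ∀ n ∈ CrystalSST.spectrum2 S, ∀ (a θ : ℝ) (b : CrystalSST.Plane),
            (a, θ, b) ∈ CrystalSST.setR s t w M N r ε f ∩ CrystalSST.setZ s t d M N r F φ n →
            DifferentiableAt ℝ (fun b' => CrystalSST.transform s t w f a θ b') b ∧
            ‖CrystalSST.waveVectorEstimate s t w f a θ b -
                CrystalSST.toComplex (CrystalSST.localWaveVector N F φ n b)‖ /
              ‖CrystalSST.localWaveVector N F φ n b‖ ≤ η := by
  intro r hr ε hε η hη
  have hlarge := (CrystalSST.eventually_pairwiseDisjoint_setZ hst (by linarith) ht d hM hr).and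
    ((CrystalSST.eventually_setR_subset_iUnion_setZ hs hst ht hM hw r hε).and
      (CrystalSST.eventually_waveVectorEstimate_sub_le hst ht d hM w r hε hη))
  obtain ⟨N₀, hN₀, hall⟩ := (atTop_basis_Ioi' 0).eventually_iff.1 hlarge
  refine ⟨N₀, hN₀, fun N hN F hF α S φ f h => ?_⟩
  obtain ⟨hdisjoint, hcover, hestimate⟩ := hall hN
  refine ⟨⟨hdisjoint F hF α S φ f h, hcover F hF α S φ f h⟩, fun n hn a θ b hp => ⟨?_, ?_⟩⟩
  · obtain ⟨_, hderiv, -⟩ := CrystalSST.exists_hasFDerivAt_transform hst w h.continuous h.norm_le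
      hp.1.1.1 θ b
    exact hderiv.differentiableAt
  · exact hestimate F hF α S φ f h n hn a θ b hp

theorem mainTheorem1 (s t d M : ℝ) (hs : 1 / 2 < s) (hst : s ≤ t) (ht : t < 1)
    (hd : 0 < d) (hd1 : d ≤ 1) (hM : 0 < M)
    (w : SchwartzMap CrystalSST.Plane ℂ) (hw : CrystalSST.IsMotherWavePacket s t d w) :
    ∃ C : ℝ, 0 < C ∧ ∀ r : ℝ, 1 < r → ∀ ε : ℝ, 0 < ε → ∃ N₀ : ℝ, 0 < N₀ ∧
      ∀ N : ℝ, N₀ < N → ∀ F : Matrix (Fin 2) (Fin 2) ℝ,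
        (∀ n : Fin 2 → ℤ, n ≠ 0 → 1 ≤ ‖CrystalSST.rowVec F n‖) →
        ∀ (α : CrystalSST.Plane → ℝ) (S : CrystalSST.Plane → ℂ)
          (φ : CrystalSST.Plane → CrystalSST.Plane) (f : CrystalSST.Plane → ℂ),
          CrystalSST.IsGIMT M N F α S φ f →
          ((CrystalSST.spectrum2 S).PairwiseDisjoint (CrystalSST.setZ s t d M N r F φ) ∧
            CrystalSST.setR s t w M N r ε f ⊆
              ⋃ n ∈ CrystalSST.spectrum2 S, CrystalSST.setZ s t d M N r F φ n) ∧
          ∀ n ∈ CrystalSST.spectrum2 S, ∀ (a θ : ℝ) (b : CrystalSST.Plane),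
            (a, θ, b) ∈ CrystalSST.setR s t w M N r ε f ∩ CrystalSST.setZ s t d M N r F φ n →
            DifferentiableAt ℝ (fun b' => CrystalSST.transform s t w f a θ b') b ∧
            ‖CrystalSST.waveVectorEstimate s t w f a θ b -
                CrystalSST.toComplex (CrystalSST.localWaveVector N F φ n b)‖ /
              ‖CrystalSST.localWaveVector N F φ n b‖ ≤ C * √ε := by
  refine ⟨1, one_pos, fun r hr ε hε => ?_⟩
  rw [one_mul]
  exact mainTheorem1_general s t d M hs hst ht hM w (fun _ => hw.fourier_eq_zero) r
    (one_pos.trans hr) ε hε _ (Real.sqrt_pos.2 hε)
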